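/- All manifolds are smooth, Hausdorff, second countable, of finite constant dimension and without boundary (the empty manifold is allowed); vector bundles are smooth, real and of finite constant rank. Let $\mathbb Z^{<0}\mathsf{Vectbd}$ be the category whose objects are the $\mathbb Z^{<0}$-graded vector bundles $V_\bullet=(V_k)_{k<0}$ over a manifold $M$ (a vector bundle $V_k\to M$ for each integer $k<0$; infinitely many of them may be non-zero) and whose morphisms $V_\bullet\to W_\bullet$ (over manifolds $M$, $N$) are smooth maps $\varphi:M\to N$ together with smooth fibrewise linear maps $V_k\to W_k$ over $\varphi$ for all $k<0$. For a graded vector bundle $E_\bullet$ let $S^{\ge 0}(E_\bullet)$ be its graded-symmetric algebra bundle (with $vw=(-1)^{|v||w|}wv$ and $S^0$ the trivial line bundle in degree $0$), graded by total degree, let $S^{\ge 1}(E_\bullet)$ be the part of positive symmetric power, and let $\Gamma(S^{\ge 0}(E_\bullet))$ be the direct sum over all $n\in\mathbb Z$ of the spaces of smooth sections of total degree $n$. The dual $V_k^*$ is placed in degree $-k$. An N-manifold $\mathcal M$ is a $\mathbb Z$-graded graded-commutative unital $\mathbb R$-algebra $C(\mathcal M)$ for which there exist a $\mathbb Z^{<0}$-graded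 vector bundle $V_\bullet$ and an isomorphism of graded algebras $C(\mathcal M)\cong\Gamma(S^{\ge 0}(V_\bullet^*))$ (a splitting of $\mathcal M$). A morphism $\mathcal M\to\mathcal N$ of N-manifolds is a morphism of graded unital $\mathbb R$-algebras $C(\mathcal N)\to C(\mathcal M)$. Let $\mathsf{NMfd}$ be the category of N-manifolds, and let $$\mathfrak S:\mathbb Z^{<0}\mathsf{Vectbd}\to\mathsf{NMfd},\qquad C(\mathfrak S(V_\bullet))=\Gamma(S^{\ge 0}(V_\bullet^*)),$$ be the functor that sends a morphism $f:V_\bullet\to W_\bullet$ to the pullback $S^{\ge 0}(f^*):\Gamma(S^{\ge 0}(W_\bullet^*))\to\Gamma(S^{\ge 0}(V_\bullet^*))$. Then $\mathfrak S$ preserves all limits that exist in $\mathbb Z^{<0}\mathsf{Vectbd}$. Moreover, $\mathfrak S$ is right adjoint to a functor $\mathfrak F:\mathsf{NMfd}\to\mathbb Z^{<0}\mathsf{Vectbd}$ such that, for every N-manifold $\mathcal M$ and every splitting $\mathcal M\cong\mathfrak S(V_\bullet)$, the graded vector bundle $\mathfrak F(\mathcal M)$ is isomorphic to $S^{\ge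 1}(V_\bullet)$ with its total grading. -/

import Mathlib

open scoped DirectSum Manifold ContDiff Topology
open Bundle CategoryTheory Limits

universe u w w'

noncomputable section

section GradedSymmetricAlgebra

/-- The Koszul sign `(-1)^(m n)`. -/
def koszulSign (m n : ℤ) : ℝ := (((m * n).negOnePow : ℤ) : ℝ)

theorem koszulSign_zero_right (m : ℤ) : koszulSign m 0 = 1 := by simp [koszulSign]

theorem koszulSign_zero_left (m : ℤ) : koszulSign 0 m = 1 := by simp [koszulSign]

theorem koszulSign_add_right (m n k : ℤ) :
    koszulSign m (n + k) = koszulSign m n * koszulSign m k := by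
  simp [koszulSign, mul_add, Int.negOnePow_add]

theorem koszulSign_add_left (m n k : ℤ) :
    koszulSign (m + n) k = koszulSign m k * koszulSign n k := by
  simp [koszulSign, add_mul, Int.negOnePow_add]

variable {ι : Type*} [DecidableEq ι] (deg : ι → ℤ) (W : ι → Type*)
  [∀ i, AddCommGroup (W i)] [∀ i, Module ℝ (W i)]

/-- The Koszul commutation relations `v ⊗ w = (-1)^(|v||w|) w ⊗ v` in the tensor algebra of a graded
real vector space `⨁ i, W i`, where `W i` is placed in degree `deg i`.  (For `v = w` of odd degree
this gives `2 v² = 0`, hence `v² = 0`.) -/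
inductive GSymRel : TensorAlgebra ℝ (⨁ i, W i) → TensorAlgebra ℝ (⨁ i, W i) → Prop
  | comm (i j : ι) (v : W i) (w : W j) :
      GSymRel
        (TensorAlgebra.ι ℝ (DirectSum.lof ℝ ι W i v) * TensorAlgebra.ι ℝ (DirectSum.lof ℝ ι W j w))
        (koszulSign (deg i) (deg j) • (TensorAlgebra.ι ℝ (DirectSum.lof ℝ ι W j w) *
          TensorAlgebra.ι ℝ (DirectSum.lof ℝ ι W i v)))

/-- The (augmented) graded-symmetric algebra `S^{≥ 0}(⨁ i, W i)`. -/
def GSym : Type _ := RingQuot (GSymRel deg W)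

namespace GSym

instance : Ring (GSym deg W) := inferInstanceAs (Ring (RingQuot (GSymRel deg W)))

instance : Algebra ℝ (GSym deg W) := inferInstanceAs (Algebra ℝ (RingQuot (GSymRel deg W)))

variable {W}

/-- The inclusion of the generators of degree `deg i`. -/
def gen (i : ι) : W i →ₗ[ℝ] GSym deg W :=
  (RingQuot.mkAlgHom ℝ (GSymRel deg W)).toLinearMap ∘ₗ TensorAlgebra.ι ℝ ∘ₗ DirectSum.lof ℝ ι W i

theorem gen_mul_gen (i j : ι) (v : W i) (w : W j) :
    gen deg i v * gen deg j w =
      koszulSign (deg i) (deg j) • (gen deg j w * gen deg i v) := by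
  have h := RingQuot.mkAlgHom_rel ℝ (GSymRel.comm (deg := deg) i j v w)
  rw [map_mul, map_smul, map_mul] at h
  exact h

/-- The universal property of the graded-symmetric algebra. -/
def lift {A : Type*} [Semiring A] [Algebra ℝ A] (f : ∀ i, W i →ₗ[ℝ] A)
    (hf : ∀ i j v w, f i v * f j w = koszulSign (deg i) (deg j) • (f j w * f i v)) :
    GSym deg W →ₐ[ℝ] A :=
  RingQuot.liftAlgHom ℝ ⟨TensorAlgebra.lift ℝ (DirectSum.toModule ℝ ι A f), by
    rintro _ _ ⟨i, j, v, w⟩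
    simpa [map_mul, map_smul, DirectSum.toModule_lof] using hf i j v w⟩

@[simp]
theorem lift_gen {A : Type*} [Semiring A] [Algebra ℝ A] (f : ∀ i, W i →ₗ[ℝ] A)
    (hf : ∀ i j v w, f i v * f j w = koszulSign (deg i) (deg j) • (f j w * f i v))
    (i : ι) (v : W i) : lift deg f hf (gen deg i v) = f i v := by
  rw [lift, gen]
  erw [RingQuot.liftAlgHom_mkAlgHom_apply]
  simp [DirectSum.toModule_lof]

theorem algHom_ext {A : Type*} [Semiring A] [Algebra ℝ A] {f g : GSym deg W →ₐ[ℝ] A}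
    (h : ∀ i v, f (gen deg i v) = g (gen deg i v)) : f = g := by
  apply RingQuot.ringQuot_ext'
  apply TensorAlgebra.hom_ext
  apply DirectSum.linearMap_ext
  intro i
  ext v
  exact h i v

/-- The product `w₁ ⋯ wᵣ` of a finite sequence of generators. -/
def monomial (l : List (Σ i, W i)) : GSym deg W := (l.map fun p => gen deg p.1 p.2).prod

/-- The total degree of a finite sequence of generators. -/
def totalDeg (l : List (Σ i, W i)) : ℤ := (l.map fun p => deg p.1).sum

variable (W) in
/-- The part of total degree `n` of the graded-symmetric algebra: the span of the products of
generators whose degrees add up to `n`. -/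
def piece (n : ℤ) : Submodule ℝ (GSym deg W) :=
  Submodule.span ℝ {z | ∃ l : List (Σ i, W i), totalDeg deg l = n ∧ monomial deg l = z}

theorem monomial_mem (l : List (Σ i, W i)) : monomial deg l ∈ piece deg W (totalDeg deg l) :=
  Submodule.subset_span ⟨l, rfl, rfl⟩

theorem gen_mem (i : ι) (v : W i) : gen deg i v ∈ piece deg W (deg i) := by
  simpa [monomial, totalDeg] using monomial_mem deg [⟨i, v⟩]

instance : SetLike.GradedMonoid (piece deg W) where
  one_mem := by simpa [monomial, totalDeg] using monomial_mem (W := W) deg []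
  mul_mem i j a b ha hb := by
    refine Submodule.span_induction ?_ (by simp) (fun x y _ _ hx hy => by
      rw [add_mul]; exact add_mem hx hy) (fun r x _ hx => by
      rw [smul_mul_assoc]; exact Submodule.smul_mem _ _ hx) ha
    rintro _ ⟨l, rfl, rfl⟩
    refine Submodule.span_induction ?_ (by simp) (fun x y _ _ hx hy => by
      rw [mul_add]; exact add_mem hx hy) (fun r x _ hx => by
      rw [mul_smul_comm]; exact Submodule.smul_mem _ _ hx) hb
    rintro _ ⟨l', rfl, rfl⟩
    exact Submodule.subset_span ⟨l ++ l', by simp [totalDeg], by simp [monomial]⟩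

/-- The generators, as elements of the direct sum of the homogeneous parts. -/
def gradedGen (i : ι) : W i →ₗ[ℝ] ⨁ n, piece deg W n :=
  DirectSum.lof ℝ ℤ (fun n => piece deg W n) (deg i) ∘ₗ
    (gen deg i).codRestrict _ (gen_mem deg i)

theorem gradedGen_apply (i : ι) (v : W i) : gradedGen deg i v =
    DirectSum.of (fun n => piece deg W n) (deg i) ⟨gen deg i v, gen_mem deg i v⟩ := rfl

theorem gradedGen_comm (i j : ι) (v : W i) (w : W j) :
    gradedGen deg i v * gradedGen deg j w =
      koszulSign (deg i) (deg j) • (gradedGen deg j w * gradedGen deg i v) := by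
  rw [gradedGen_apply, gradedGen_apply, DirectSum.of_mul_of, DirectSum.of_mul_of]
  refine Eq.trans ?_ ((DirectSum.lof ℝ ℤ (fun n => piece deg W n) (deg j + deg i)).map_smul _ _)
  refine DirectSum.of_eq_of_gradedMonoid_eq (Sigma.subtype_ext (add_comm _ _) ?_)
  exact gen_mul_gen deg i j v w

instance gradedAlgebra : GradedAlgebra (piece deg W) :=
  GradedAlgebra.ofAlgHom _ (lift deg (gradedGen deg) (gradedGen_comm deg))
    (by
      apply algHom_ext
      intro i v
      simp [gradedGen_apply])
    (by
      rintro n ⟨x, hx⟩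
      dsimp only
      induction hx using Submodule.span_induction with
      | mem x h =>
        obtain ⟨l, rfl, rfl⟩ := h
        induction l with
        | nil => simp only [monomial, List.map_nil, List.prod_nil, map_one]; rfl
        | cons p l ih =>
          have : monomial deg (p :: l) = gen deg p.1 p.2 * monomial deg l := by simp [monomial]
          simp only [this, map_mul, lift_gen, gradedGen_apply, ih, DirectSum.of_mul_of]
          refine DirectSum.of_eq_of_gradedMonoid_eq (Sigma.subtype_ext ?_ rfl)
          simp [totalDeg, GradedMonoid.mk]
      | zero => rw [map_zero]; exact (map_zero _).symm
      | add x y hx hy ihx ihy =>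
        rw [map_add, ihx, ihy, ← map_add]; rfl
      | smul r x hx ih =>
        rw [map_smul, ih, ← DirectSum.lof_eq_of ℝ, ← map_smul]; rfl)

theorem gen_mul_monomial (i : ι) (v : W i) (l : List (Σ i, W i)) :
    gen deg i v * monomial deg l =
      koszulSign (deg i) (totalDeg deg l) • (monomial deg l * gen deg i v) := by
  induction l with
  | nil => simp [monomial, totalDeg, koszulSign_zero_right]
  | cons p l ih =>
    have h1 : monomial deg (p :: l) = gen deg p.1 p.2 * monomial deg l := by simp [monomial]
    have h2 : totalDeg deg (p :: l) = deg p.1 + totalDeg deg l := by simp [totalDeg]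
    rw [h1, h2, ← mul_assoc, gen_mul_gen, smul_mul_assoc, mul_assoc, ih, mul_smul_comm, smul_smul,
      koszulSign_add_right, mul_assoc]

theorem monomial_mul_monomial (l l' : List (Σ i, W i)) :
    monomial deg l * monomial deg l' =
      koszulSign (totalDeg deg l) (totalDeg deg l') • (monomial deg l' * monomial deg l) := by
  induction l with
  | nil => simp [monomial, totalDeg, koszulSign_zero_left]
  | cons p l ih =>
    have h1 : monomial deg (p :: l) = gen deg p.1 p.2 * monomial deg l := by simp [monomial]
    have h2 : totalDeg deg (p :: l) = deg p.1 + totalDeg deg l := by simp [totalDeg]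
    rw [h1, h2, mul_assoc, ih, mul_smul_comm, ← mul_assoc, gen_mul_monomial, smul_mul_assoc,
      smul_smul, koszulSign_add_left, mul_assoc, mul_comm (koszulSign _ _)]

/-- The graded-symmetric algebra is graded commutative. -/
theorem mul_comm_of_mem {m n : ℤ} {a b : GSym deg W} (ha : a ∈ piece deg W m)
    (hb : b ∈ piece deg W n) : a * b = koszulSign m n • (b * a) := by
  refine Submodule.span_induction ?_ (by simp) (fun x y _ _ hx hy => by
      rw [add_mul, mul_add, smul_add, hx, hy]) (fun r x _ hx => by
      rw [smul_mul_assoc, mul_smul_comm, hx, smul_comm]) ha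
  rintro _ ⟨l, rfl, rfl⟩
  refine Submodule.span_induction ?_ (by simp) (fun x y _ _ hx hy => by
      rw [add_mul, mul_add, smul_add, hx, hy]) (fun r x _ hx => by
      rw [smul_mul_assoc, mul_smul_comm, hx, smul_comm]) hb
  rintro _ ⟨l', rfl, rfl⟩
  exact monomial_mul_monomial deg l l'

variable {W' : ι → Type*} [∀ i, AddCommGroup (W' i)] [∀ i, Module ℝ (W' i)]
  {W'' : ι → Type*} [∀ i, AddCommGroup (W'' i)] [∀ i, Module ℝ (W'' i)]

/-- Functoriality of the graded-symmetric algebra. -/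
def map (f : ∀ i, W i →ₗ[ℝ] W' i) : GSym deg W →ₐ[ℝ] GSym deg W' :=
  lift deg (fun i => gen deg i ∘ₗ f i) fun i j v w => gen_mul_gen deg i j (f i v) (f j w)

@[simp]
theorem map_gen (f : ∀ i, W i →ₗ[ℝ] W' i) (i : ι) (v : W i) :
    map deg f (gen deg i v) = gen deg i (f i v) := by
  simp [map]

theorem map_id : map deg (fun i => (LinearMap.id : W i →ₗ[ℝ] W i)) = AlgHom.id ℝ _ :=
  algHom_ext deg (by simp)

theorem map_comp (f : ∀ i, W i →ₗ[ℝ] W' i) (g : ∀ i, W' i →ₗ[ℝ] W'' i) :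
    map deg (fun i => g i ∘ₗ f i) = (map deg g).comp (map deg f) :=
  algHom_ext deg (by simp)

theorem map_mem (f : ∀ i, W i →ₗ[ℝ] W' i) {n : ℤ} {a : GSym deg W} (ha : a ∈ piece deg W n) :
    map deg f a ∈ piece deg W' n := by
  refine Submodule.span_induction ?_ (by simp) (fun x y _ _ hx hy => by
      rw [map_add]; exact add_mem hx hy) (fun r x _ hx => by
      rw [map_smul]; exact Submodule.smul_mem _ _ hx) ha
  rintro _ ⟨l, rfl, rfl⟩
  refine Submodule.subset_span ⟨l.map fun p => ⟨p.1, f p.1 p.2⟩, ?_, ?_⟩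
  · simp [totalDeg, Function.comp_def]
  · simp [monomial, map_list_prod, Function.comp_def]

end GSym

end GradedSymmetricAlgebra

section SymmetricSections

variable {ι : Type*} [DecidableEq ι] (deg : ι → ℤ)
  {EM : Type*} [NormedAddCommGroup EM] [NormedSpace ℝ EM]
  {HM : Type*} [TopologicalSpace HM] (I : ModelWithCorners ℝ EM HM)
  {M : Type*} [TopologicalSpace M] [ChartedSpace HM M]
  (F : ι → Type*) [∀ i, NormedAddCommGroup (F i)] [∀ i, NormedSpace ℝ (F i)]
  (E : ι → M → Type*) [∀ i, TopologicalSpace (TotalSpace (F i) (E i))]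
  [∀ i x, AddCommGroup (E i x)] [∀ i x, Module ℝ (E i x)] [∀ i x, TopologicalSpace (E i x)]
  [∀ i, FiberBundle (F i) (E i)]

/-- The elementary sections, smooth at `x₀`, of the bundle of algebras `S^{≥ 0}(⨁ i, E i)` (whose
fibre at `x` is `GSym deg (fun i => E i x)`): the functions and the sections of the `E i`. -/
def symGenerators (x₀ : M) : Set (∀ x, GSym deg (fun i => E i x)) :=
  {s | ∃ f : M → ℝ, ContMDiffAt I 𝓘(ℝ) ∞ f x₀ ∧ s = fun x => algebraMap ℝ _ (f x)} ∪
  {s | ∃ (i : ι) (σ : ∀ x, E i x),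
    ContMDiffAt I (I.prod 𝓘(ℝ, F i)) ∞ (fun x => TotalSpace.mk' (F i) x (σ x)) x₀ ∧
    s = fun x => GSym.gen deg i (σ x)}

/-- The sections of `S^{≥ 0}(⨁ i, E i)` that are smooth at `x₀`: near `x₀` they are finite sums of
products `f σ₁ ⋯ σᵣ` of functions and sections of the `E i` that are smooth at `x₀`.  As the products
of the members of local frames of the `E i` make up local frames of `S^{≥ 0}(⨁ i, E i)`, this is
smoothness for the usual vector bundle structure on the symmetric powers. -/
def symSmoothAt (x₀ : M) : Subalgebra ℝ (∀ x, GSym deg (fun i => E i x)) where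
  carrier := {s | ∃ t ∈ Algebra.adjoin ℝ (symGenerators deg I F E x₀), ∀ᶠ x in 𝓝 x₀, s x = t x}
  mul_mem' := by
    rintro a b ⟨t, ht, hat⟩ ⟨u, hu, hbu⟩
    refine ⟨t * u, mul_mem ht hu, ?_⟩
    filter_upwards [hat, hbu] with x h1 h2
    simp [h1, h2]
  add_mem' := by
    rintro a b ⟨t, ht, hat⟩ ⟨u, hu, hbu⟩
    refine ⟨t + u, add_mem ht hu, ?_⟩
    filter_upwards [hat, hbu] with x h1 h2
    simp [h1, h2]
  algebraMap_mem' r := ⟨_, Subalgebra.algebraMap_mem _ r, Filter.Eventually.of_forall fun _ => rfl⟩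

/-- The smooth sections of the part of total degree `k` of the bundle `S^{≥ 0}(⨁ i, E i)`. -/
def symSections (k : ℤ) : Submodule ℝ (∀ x, GSym deg (fun i => E i x)) where
  carrier := {s | (∀ x, s x ∈ GSym.piece deg (fun i => E i x) k) ∧
    ∀ x, s ∈ symSmoothAt deg I F E x}
  add_mem' ha hb := ⟨fun x => add_mem (ha.1 x) (hb.1 x), fun x => add_mem (ha.2 x) (hb.2 x)⟩
  zero_mem' := ⟨fun _ => zero_mem _, fun _ => zero_mem _⟩
  smul_mem' r _ ha := ⟨fun x => Submodule.smul_mem _ r (ha.1 x),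
    fun x => Subalgebra.smul_mem _ (ha.2 x) r⟩

instance : SetLike.GradedMonoid (symSections deg I F E) where
  one_mem := ⟨fun _ => SetLike.GradedOne.one_mem, fun _ => one_mem _⟩
  mul_mem _ _ _ _ ha hb := ⟨fun x => SetLike.GradedMul.mul_mem (ha.1 x) (hb.1 x),
    fun x => mul_mem (ha.2 x) (hb.2 x)⟩

theorem symSections_iSupIndep : iSupIndep (symSections deg I F E) := by
  rw [iSupIndep_def]
  intro k
  rw [Submodule.disjoint_def]
  intro s hs hs'
  funext x
  have hind := (DirectSum.Decomposition.isInternal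
    (GSym.piece deg (fun i => E i x))).submodule_iSupIndep
  rw [iSupIndep_def] at hind
  refine Submodule.disjoint_def.1 (hind k) _ (hs.1 x) ?_
  have hle : (⨆ j, ⨆ (_ : j ≠ k), symSections deg I F E j).map (LinearMap.proj x) ≤
      ⨆ j, ⨆ (_ : j ≠ k), GSym.piece deg (fun i => E i x) j := by
    simp only [Submodule.map_iSup]
    refine iSup₂_mono fun j _ => ?_
    rintro _ ⟨t, ht, rfl⟩
    exact ht.1 x
  exact hle ⟨s, hs', rfl⟩

/-- The algebra `Γ(S^{≥ 0}(⨁ i, E i))`, the direct sum over `k` of the spaces of smooth sections of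
total degree `k`, with fibrewise multiplication. -/
def SymAlgebra : Subalgebra ℝ (∀ x, GSym deg (fun i => E i x)) :=
  (⨆ k, symSections deg I F E k).toSubalgebra
    (Submodule.mem_iSup_of_mem 0 SetLike.GradedOne.one_mem) (by
      intro a b ha hb
      refine Submodule.iSup_induction _ (motive := fun a => a * b ∈ _) ha ?_ (by simp)
        (fun x y hx hy => by rw [add_mul]; exact add_mem hx hy)
      intro i a ha
      refine Submodule.iSup_induction _ (motive := fun b => a * b ∈ _) hb ?_ (by simp)
        (fun x y hx hy => by rw [mul_add]; exact add_mem hx hy)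
      intro j b hb
      exact Submodule.mem_iSup_of_mem (i + j) (SetLike.GradedMul.mul_mem ha hb))

/-- The grading of `Γ(S^{≥ 0}(⨁ i, E i))` by total degree. -/
def symGrading (k : ℤ) : Submodule ℝ (SymAlgebra deg I F E) :=
  (symSections deg I F E k).comap (SymAlgebra deg I F E).val.toLinearMap

instance : SetLike.GradedMonoid (symGrading deg I F E) where
  one_mem := SetLike.GradedOne.one_mem (A := symSections deg I F E)
  mul_mem _ _ _ _ ha hb := SetLike.GradedMul.mul_mem (A := symSections deg I F E) ha hb

theorem symGrading_isInternal : DirectSum.IsInternal (symGrading deg I F E) := by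
  apply DirectSum.isInternal_submodule_of_iSupIndep_of_iSup_eq_top
  · rw [iSupIndep_def]
    intro k
    rw [Submodule.disjoint_def]
    intro s hs hs'
    have hind := symSections_iSupIndep deg I F E
    rw [iSupIndep_def] at hind
    apply Subtype.ext
    refine Submodule.disjoint_def.1 (hind k) _ hs ?_
    have hle : (⨆ j, ⨆ (_ : j ≠ k), symGrading deg I F E j).map
        (SymAlgebra deg I F E).val.toLinearMap ≤
        ⨆ j, ⨆ (_ : j ≠ k), symSections deg I F E j := by
      simp only [Submodule.map_iSup]
      refine iSup₂_mono fun j _ => ?_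
      rintro _ ⟨t, ht, rfl⟩
      exact ht
    exact hle ⟨s, hs', rfl⟩
  · rw [eq_top_iff]
    rintro ⟨s, hs⟩ -
    have h : ∀ t ∈ ⨆ k, symSections deg I F E k, ∃ ht : t ∈ SymAlgebra deg I F E,
        (⟨t, ht⟩ : SymAlgebra deg I F E) ∈ ⨆ k, symGrading deg I F E k := by
      intro t ht
      refine Submodule.iSup_induction _ (motive := fun t => ∃ ht : t ∈ SymAlgebra deg I F E,
        (⟨t, ht⟩ : SymAlgebra deg I F E) ∈ ⨆ k, symGrading deg I F E k) ht ?_ ?_ ?_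
      · intro k t ht
        exact ⟨Submodule.mem_iSup_of_mem (p := symSections deg I F E) k ht,
          Submodule.mem_iSup_of_mem (p := symGrading deg I F E) k ht⟩
      · exact ⟨zero_mem _, zero_mem _⟩
      · rintro x y ⟨hx, hx'⟩ ⟨hy, hy'⟩
        exact ⟨add_mem hx hy, add_mem hx' hy'⟩
    exact (h s hs).2

instance : GradedAlgebra (symGrading deg I F E) where
  toDecomposition := (symGrading_isInternal deg I F E).chooseDecomposition

theorem symGrading_comm (m n : ℤ) {a b : SymAlgebra deg I F E} (ha : a ∈ symGrading deg I F E m)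
    (hb : b ∈ symGrading deg I F E n) : a * b = koszulSign m n • (b * a) := by
  apply Subtype.ext
  funext x
  exact GSym.mul_comm_of_mem deg (ha.1 x) (hb.1 x)

end SymmetricSections

section Bundles

/-- The indices of a `ℤ^{<0}`-graded object. -/
abbrev NegInt : Type := {k : ℤ // k < 0}

/-- A `ℤ^{<0}`-graded vector bundle: a smooth (Hausdorff, second countable, finite-dimensional,
boundaryless) manifold `base` with a smooth real vector bundle `fiber k` of finite rank over it for
every integer `k < 0`. -/
structure NegGradedVectBundle : Type (u + 1) where
  dim : ℕ
  base : Type u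
  [topBase : TopologicalSpace base]
  [t2Base : T2Space base]
  [secondCountableBase : SecondCountableTopology base]
  [chartedBase : ChartedSpace (EuclideanSpace ℝ (Fin dim)) base]
  [manifoldBase : IsManifold (𝓡 dim) ∞ base]
  rank : NegInt → ℕ
  fiber : NegInt → base → Type u
  [addCommGroupFiber : ∀ k x, AddCommGroup (fiber k x)]
  [moduleFiber : ∀ k x, Module ℝ (fiber k x)]
  [topFiber : ∀ k x, TopologicalSpace (fiber k x)]
  [topTotal : ∀ k, TopologicalSpace (TotalSpace (EuclideanSpace ℝ (Fin (rank k))) (fiber k))]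
  [fiberBundle : ∀ k, FiberBundle (EuclideanSpace ℝ (Fin (rank k))) (fiber k)]
  [vectorBundle : ∀ k, VectorBundle ℝ (EuclideanSpace ℝ (Fin (rank k))) (fiber k)]
  [smoothBundle : ∀ k,
    ContMDiffVectorBundle ∞ (EuclideanSpace ℝ (Fin (rank k))) (fiber k) (𝓡 dim)]

namespace NegGradedVectBundle

attribute [instance] topBase t2Base secondCountableBase chartedBase manifoldBase
  addCommGroupFiber moduleFiber topFiber topTotal fiberBundle vectorBundle smoothBundle

/-- The model fibre in degree `k`. -/
abbrev modelFiber (V : NegGradedVectBundle.{u}) (k : NegInt) : Type :=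
  EuclideanSpace ℝ (Fin (V.rank k))

/-- A morphism of graded vector bundles: a smooth map of the bases covered by smooth fibrewise
linear maps in every degree. -/
structure Hom (V W : NegGradedVectBundle.{u}) where
  onBase : V.base → W.base
  contMDiff_onBase : ContMDiff (𝓡 V.dim) (𝓡 W.dim) ∞ onBase
  onFiber : ∀ k x, V.fiber k x →L[ℝ] W.fiber k (onBase x)
  contMDiff_onFiber : ∀ k, ContMDiff ((𝓡 V.dim).prod 𝓘(ℝ, V.modelFiber k))
    ((𝓡 W.dim).prod 𝓘(ℝ, W.modelFiber k)) ∞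
    (fun p : TotalSpace (V.modelFiber k) (V.fiber k) =>
      TotalSpace.mk' (W.modelFiber k) (onBase p.1) (onFiber k p.1 p.2))

/-- The category of `ℤ^{<0}`-graded vector bundles. -/
instance : Category NegGradedVectBundle.{u} where
  Hom := Hom
  id V :=
    { onBase := id
      contMDiff_onBase := contMDiff_id
      onFiber := fun _ _ => ContinuousLinearMap.id ℝ _
      contMDiff_onFiber := fun _ => contMDiff_id }
  comp f g :=
    { onBase := g.onBase ∘ f.onBase
      contMDiff_onBase := g.contMDiff_onBase.comp f.contMDiff_onBase
      onFiber := fun k x => (g.onFiber k (f.onBase x)).comp (f.onFiber k x)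
      contMDiff_onFiber := fun k => (g.contMDiff_onFiber k).comp (f.contMDiff_onFiber k) }

/-- The dual bundle of `V k`, a Mathlib bundle of continuous linear maps. -/
abbrev dualFiber (V : NegGradedVectBundle.{u}) (k : NegInt) (x : V.base) : Type u :=
  V.fiber k x →L[ℝ] Trivial V.base ℝ x

/-- The degree `-k` of the dual of `V k`. -/
def dualDeg (k : NegInt) : ℤ := -k.1

/-- The algebra `Γ(S^{≥ 0}(V^*))`. -/
abbrev functionAlgebra (V : NegGradedVectBundle.{u}) :
    Subalgebra ℝ (∀ x, GSym dualDeg (fun k => V.dualFiber k x)) :=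
  SymAlgebra dualDeg (𝓡 V.dim) (fun k => V.modelFiber k →L[ℝ] ℝ) V.dualFiber

/-- The grading of `Γ(S^{≥ 0}(V^*))` by total degree. -/
abbrev functionGrading (V : NegGradedVectBundle.{u}) : ℤ → Submodule ℝ V.functionAlgebra :=
  symGrading dualDeg (𝓡 V.dim) (fun k => V.modelFiber k →L[ℝ] ℝ) V.dualFiber

/-- The pullback of a smooth section of the dual bundle along a bundle morphism is smooth. -/
theorem contMDiffAt_pullback {V W : NegGradedVectBundle.{u}} (f : Hom V W) (k : NegInt)
    (σ : ∀ y, W.dualFiber k y) (x₀ : V.base)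
    (hσ : ContMDiffAt (𝓡 W.dim) ((𝓡 W.dim).prod 𝓘(ℝ, W.modelFiber k →L[ℝ] ℝ)) ∞
      (fun y => TotalSpace.mk' (W.modelFiber k →L[ℝ] ℝ) y (σ y)) (f.onBase x₀)) :
    ContMDiffAt (𝓡 V.dim) ((𝓡 V.dim).prod 𝓘(ℝ, V.modelFiber k →L[ℝ] ℝ)) ∞
      (fun x => TotalSpace.mk' (V.modelFiber k →L[ℝ] ℝ) (E := V.dualFiber k) x
        ((σ (f.onBase x)).comp (f.onFiber k x))) x₀ := by
  set e := trivializationAt (V.modelFiber k) (V.fiber k) x₀ with he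
  have hx₀ : x₀ ∈ e.baseSet := mem_baseSet_trivializationAt _ _ _
  set G : V.base → V.modelFiber k →L[ℝ] ℝ := fun x =>
    ContinuousLinearMap.inCoordinates (V.modelFiber k) (V.fiber k) ℝ (Trivial V.base ℝ) x₀ x x₀ x
      ((σ (f.onBase x)).comp (f.onFiber k x)) with hG
  rw [contMDiffAt_hom_bundle]
  refine ⟨contMDiffAt_id, ?_⟩
  change ContMDiffAt (𝓡 V.dim) 𝓘(ℝ, V.modelFiber k →L[ℝ] ℝ) ∞ G x₀
  have key : ∀ v : V.modelFiber k, ContMDiffAt (𝓡 V.dim) 𝓘(ℝ) ∞ (fun x => G x v) x₀ := by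
    intro v
    have h1 : ContMDiffAt (𝓡 V.dim) ((𝓡 V.dim).prod 𝓘(ℝ, V.modelFiber k)) ∞
        (fun x => TotalSpace.mk' (V.modelFiber k) x (e.symm x v)) x₀ := by
      refine contMDiffAt_totalSpace.2 ⟨contMDiffAt_id, ?_⟩
      refine (contMDiffAt_const (c := v)).congr_of_eventuallyEq ?_
      filter_upwards [e.open_baseSet.mem_nhds hx₀] with x hx
      exact congrArg Prod.snd (e.apply_mk_symm hx v)
    have h2 : ContMDiffAt (𝓡 V.dim) ((𝓡 W.dim).prod 𝓘(ℝ, W.modelFiber k)) ∞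
        (fun x => TotalSpace.mk' (W.modelFiber k) (f.onBase x)
          (f.onFiber k x (e.symm x v))) x₀ :=
      (f.contMDiff_onFiber k).contMDiffAt.comp x₀ h1
    have h3 := ((contMDiffAt_hom_bundle _).1 hσ).2.comp x₀ f.contMDiff_onBase.contMDiffAt
    have h4 := ContMDiffAt.clm_apply_of_inCoordinates h3 h2 f.contMDiff_onBase.contMDiffAt
    have h5 := (contMDiffAt_totalSpace.1 h4).2
    refine h5.congr_of_eventuallyEq ?_
    filter_upwards [e.open_baseSet.mem_nhds hx₀] with x hx
    simp [hG, ContinuousLinearMap.inCoordinates, Trivialization.symmL_apply _ hx, ← he]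
  have hsum : G = fun x => ∑ i, G x (EuclideanSpace.single i 1) •
      (EuclideanSpace.proj i : V.modelFiber k →L[ℝ] ℝ) := by
    funext x
    ext v
    conv_lhs => rw [← (EuclideanSpace.basisFun (Fin (V.rank k)) ℝ).sum_repr v]
    simp [mul_comm]
  rw [hsum]
  exact ContMDiffAt.sum fun i _ => (key _).smul contMDiffAt_const

/-- The transpose of a bundle morphism on the dual fibres. -/
def dualMap {V W : NegGradedVectBundle.{u}} (f : Hom V W) (k : NegInt) (x : V.base) :
    W.dualFiber k (f.onBase x) →ₗ[ℝ] V.dualFiber k x where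
  toFun ξ := ξ.comp (f.onFiber k x)
  map_add' _ _ := rfl
  map_smul' _ _ := rfl

/-- The map `S^{≥ 0}(f^*)`: the pullback of (not necessarily smooth) sections of `S^{≥ 0}(W^*)`
along a bundle morphism `V ⟶ W`. -/
def pullback {V W : NegGradedVectBundle.{u}} (f : Hom V W) :
    (∀ y, GSym dualDeg (fun k => W.dualFiber k y)) →ₐ[ℝ]
      (∀ x, GSym dualDeg (fun k => V.dualFiber k x)) :=
  AlgHom.pi fun x =>
    (GSym.map dualDeg fun k => dualMap f k x).comp
      (Pi.evalAlgHom ℝ (fun y => GSym dualDeg (fun k => W.dualFiber k y)) (f.onBase x))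

theorem pullback_apply {V W : NegGradedVectBundle.{u}} (f : Hom V W)
    (s : ∀ y, GSym dualDeg (fun k => W.dualFiber k y)) (x : V.base) :
    pullback f s x = GSym.map dualDeg (fun k => dualMap f k x) (s (f.onBase x)) :=
  rfl

theorem pullback_smoothAt {V W : NegGradedVectBundle.{u}} (f : Hom V W) (x₀ : V.base)
    {s : ∀ y, GSym dualDeg (fun k => W.dualFiber k y)}
    (hs : s ∈ symSmoothAt dualDeg (𝓡 W.dim) (fun k => W.modelFiber k →L[ℝ] ℝ) W.dualFiber
      (f.onBase x₀)) :
    pullback f s ∈ symSmoothAt dualDeg (𝓡 V.dim) (fun k => V.modelFiber k →L[ℝ] ℝ) V.dualFiber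
      x₀ := by
  obtain ⟨t, ht, hst⟩ := hs
  refine ⟨pullback f t, ?_, ?_⟩
  · have h : (Algebra.adjoin ℝ (symGenerators dualDeg (𝓡 W.dim)
        (fun k => W.modelFiber k →L[ℝ] ℝ) W.dualFiber (f.onBase x₀))).map (pullback f) ≤
        Algebra.adjoin ℝ (symGenerators dualDeg (𝓡 V.dim)
        (fun k => V.modelFiber k →L[ℝ] ℝ) V.dualFiber x₀) := by
      rw [AlgHom.map_adjoin]
      refine Algebra.adjoin_mono ?_
      rintro _ ⟨_, ⟨g, hg, rfl⟩ | ⟨k, σ, hσ, rfl⟩, rfl⟩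
      · refine Or.inl ⟨g ∘ f.onBase, hg.comp x₀ f.contMDiff_onBase.contMDiffAt, ?_⟩
        funext x
        simp [pullback_apply]
      · refine Or.inr ⟨k, _, contMDiffAt_pullback f k σ x₀ hσ, ?_⟩
        funext x
        simp only [pullback_apply, GSym.map_gen]
        rfl
    exact h ⟨t, ht, rfl⟩
  · filter_upwards [f.contMDiff_onBase.continuous.continuousAt.eventually hst] with x hx
    rw [pullback_apply, pullback_apply, hx]

theorem pullback_mem_symSections {V W : NegGradedVectBundle.{u}} (f : Hom V W) (n : ℤ)
    {s : ∀ y, GSym dualDeg (fun k => W.dualFiber k y)}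
    (hs : s ∈ symSections dualDeg (𝓡 W.dim) (fun k => W.modelFiber k →L[ℝ] ℝ) W.dualFiber n) :
    pullback f s ∈ symSections dualDeg (𝓡 V.dim) (fun k => V.modelFiber k →L[ℝ] ℝ) V.dualFiber n :=
  ⟨fun x => GSym.map_mem dualDeg _ (hs.1 (f.onBase x)),
    fun x => pullback_smoothAt f x (hs.2 (f.onBase x))⟩

theorem pullback_mem {V W : NegGradedVectBundle.{u}} (f : Hom V W)
    {s : ∀ y, GSym dualDeg (fun k => W.dualFiber k y)} (hs : s ∈ W.functionAlgebra) :
    pullback f s ∈ V.functionAlgebra := by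
  have h : (⨆ n, symSections dualDeg (𝓡 W.dim) (fun k => W.modelFiber k →L[ℝ] ℝ)
      W.dualFiber n).map (pullback f).toLinearMap ≤
      ⨆ n, symSections dualDeg (𝓡 V.dim) (fun k => V.modelFiber k →L[ℝ] ℝ) V.dualFiber n := by
    rw [Submodule.map_iSup]
    refine iSup_mono fun n => ?_
    rintro _ ⟨t, ht, rfl⟩
    exact pullback_mem_symSections f n ht
  exact h ⟨s, hs, rfl⟩

/-- The morphism of graded algebras `S^{≥ 0}(f^*) : Γ(S^{≥ 0}(W^*)) → Γ(S^{≥ 0}(V^*))` induced by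
a morphism `f : V ⟶ W` of graded vector bundles. -/
def functionMap {V W : NegGradedVectBundle.{u}} (f : Hom V W) :
    W.functionGrading →ₐᵍ[ℝ] V.functionGrading where
  toAlgHom := ((pullback f).comp W.functionAlgebra.val).codRestrict V.functionAlgebra
    fun s => pullback_mem f s.2
  map_mem {n _} hs := pullback_mem_symSections f n hs

theorem functionMap_id (V : NegGradedVectBundle.{u}) :
    functionMap (𝟙 V : V ⟶ V) = GradedAlgHom.id ℝ V.functionGrading := by
  apply GradedAlgHom.coe_fn_injective
  funext s
  apply Subtype.ext
  funext x
  exact DFunLike.congr_fun (GSym.map_id _) (s.1 x)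

theorem pullback_comp {V W Z : NegGradedVectBundle.{u}} (f : V ⟶ W) (g : W ⟶ Z)
    (s : ∀ y, GSym dualDeg (fun k => Z.dualFiber k y)) :
    pullback (f ≫ g) s = pullback f (pullback g s) := by
  funext x
  have h := GSym.map_comp dualDeg
    (fun k => dualMap g k (f.onBase x)) (fun k => dualMap f k x)
  exact DFunLike.congr_fun h (s (g.onBase (f.onBase x)))

theorem functionMap_comp {V W Z : NegGradedVectBundle.{u}} (f : V ⟶ W) (g : W ⟶ Z) :
    functionMap (f ≫ g) = (functionMap f).comp (functionMap g) := by
  apply GradedAlgHom.coe_fn_injective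
  funext s
  apply Subtype.ext
  exact pullback_comp f g s.1

end NegGradedVectBundle

/-- An N-manifold: a `ℤ`-graded graded-commutative real algebra (the algebra of functions) that is
isomorphic, as a graded algebra, to `Γ(S^{≥ 0}(V^*))` for some `ℤ^{<0}`-graded vector bundle `V`. -/
structure NManifold : Type (u + 1) where
  functions : Type u
  [ring : Ring functions]
  [algebra : Algebra ℝ functions]
  grading : ℤ → Submodule ℝ functions
  [gradedAlgebra : GradedAlgebra grading]
  graded_comm : ∀ (m n : ℤ) (a b : functions), a ∈ grading m → b ∈ grading n →
    a * b = koszulSign m n • (b * a)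
  exists_splitting : ∃ (V : NegGradedVectBundle.{u}) (e : functions ≃ₐ[ℝ] V.functionAlgebra),
    ∀ n a, a ∈ grading n ↔ e a ∈ V.functionGrading n

namespace NManifold

attribute [instance] ring algebra gradedAlgebra

/-- The category of N-manifolds: a morphism `X ⟶ Y` is a morphism of graded algebras
`C(Y) → C(X)`. -/
instance : Category NManifold.{u} where
  Hom X Y := Y.grading →ₐᵍ[ℝ] X.grading
  id X := GradedAlgHom.id ℝ X.grading
  comp f g := f.comp g

end NManifold

/-- The functor `𝔖` from `ℤ^{<0}`-graded vector bundles to N-manifolds with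
`C(𝔖(V)) = Γ(S^{≥ 0}(V^*))`. -/
def splitNManifold : NegGradedVectBundle.{u} ⥤ NManifold.{u} where
  obj V :=
    { functions := V.functionAlgebra
      grading := V.functionGrading
      graded_comm := fun m n _ _ ha hb => symGrading_comm _ _ _ _ m n ha hb
      exists_splitting := ⟨V, AlgEquiv.refl, fun _ _ => Iff.rfl⟩ }
  map f := NegGradedVectBundle.functionMap f
  map_id V := NegGradedVectBundle.functionMap_id V
  map_comp f g := NegGradedVectBundle.functionMap_comp f g

/-- The graded vector bundle `E` is (isomorphic to) the negatively graded vector bundle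
`S^{≥ 1}(V)` with its total grading: there is a diffeomorphism of the bases covered by fibrewise
linear isomorphisms from the parts of degree `k < 0` of `S^{≥ 0}(V x)` to the fibres of `E` in
degree `k` under which the smooth sections correspond.  (All generators have negative degree, so
the parts of negative degree of `S^{≥ 0}(V x)` make up `S^{≥ 1}(V x)`.) -/
def IsReducedSymmetricBundle (V E : NegGradedVectBundle.{u}) : Prop :=
  ∃ (φ : V.base ≃ₘ^∞⟮𝓡 V.dim, 𝓡 E.dim⟯ E.base)
    (θ : ∀ (k : NegInt) (x : V.base),
      GSym.piece (fun j : NegInt => j.1) (fun j => V.fiber j x) k.1 ≃ₗ[ℝ] E.fiber k (φ x)),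
    ∀ (k : NegInt)
      (s : ∀ x, GSym.piece (fun j : NegInt => j.1) (fun j => V.fiber j x) k.1) (x₀ : V.base),
      (fun x => (s x : GSym (fun j : NegInt => j.1) (fun j => V.fiber j x))) ∈
          symSmoothAt (fun j : NegInt => j.1) (𝓡 V.dim) V.modelFiber V.fiber x₀ ↔
        ContMDiffAt (𝓡 V.dim) ((𝓡 E.dim).prod 𝓘(ℝ, E.modelFiber k)) ∞
          (fun x => TotalSpace.mk' (E.modelFiber k) (φ x) (θ k x (s x))) x₀

end Bundles

end

/-! The goal is to corepresent, for every N-manifold `X ≅ 𝔖(V)`, the functor sending `W` to the set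
of morphisms `X ⟶ 𝔖(W)` by the bundle `D = S^{≥ 1}(V)`. Pointwise corepresentability yields a left
adjoint, right adjoints preserve limits, and uniqueness of corepresenting objects identifies the
value of the adjoint for every splitting.

Let `V` and `W` have bases `M` and `N`. A morphism `𝔖(V) ⟶ 𝔖(W)` is a graded algebra morphism `Φ`
from `Γ(S(W^*))` to `Γ(S(V^*))`. In degree `0` it is an algebra morphism from the smooth functions
on `N` to those on `M`, hence the pullback along a smooth map `φ` (`exists_eq_eval_of_character`,
`exists_pullback_map`). On sections of the dual of `W_k` it takes values in the degree `-k` part of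
`Γ(S(V^*))`, which is isomorphic to the sections of the dual of `D_k`, and it is linear over `φ^*`.
So it is the transpose of a unique bundle map `D_k → W_k` over `φ` (`exists_fiberMap`,
`contMDiff_fiberMap`). Since functions and dual sections generate the function algebra locally
(`mem_polynomialNear`), these data determine `Φ` (`functionAlgebra_algHom_ext`). Hence every `Φ`
factors uniquely through the unit, the algebra morphism extending the isomorphism of the duals of
the `D_k` with the parts of `S(V^*)` (`exists_unit_comp`, `unit_comp_injective`).

Two points need geometric work. Infinitely many `V_k` may be non-zero, but a fixed total degree
involves only finitely many generators and products of bounded length. Therefore each homogeneous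
part has finite rank and is locally trivial on a finite intersection of trivializing sets
(`symPrebundle`). The isomorphism of the dual of `D_k` with a part of `S(V^*)` is built from bundle
metrics (`exists_equiv_dual`); any such isomorphism matching smooth sections serves. -/

noncomputable section

set_option linter.unusedSectionVars false

/-! ### Homogeneous parts of graded-symmetric algebras with locally finite generators -/

section GSymLemmas

/-- A degree function `deg : ι → ℤ` is positive and locally finite up to the sign `ε`: the numbers
`ε * deg i` are positive and only finitely many of them are below any given bound. -/
structure IsLocallyFiniteDeg {ι : Type*} (deg : ι → ℤ) (ε : ℤ) : Prop where
  pos : ∀ i, 0 < ε * deg i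
  finite : ∀ n : ℤ, {i | ε * deg i ≤ n}.Finite

variable {ι : Type*} [DecidableEq ι] {deg : ι → ℤ} {ε : ℤ}

namespace GSym

variable {W : ι → Type*} [∀ i, AddCommGroup (W i)] [∀ i, Module ℝ (W i)]
  {W' : ι → Type*} [∀ i, AddCommGroup (W' i)] [∀ i, Module ℝ (W' i)]

theorem totalDeg_cons (p : Σ i, W i) (l : List (Σ i, W i)) :
    totalDeg deg (p :: l) = deg p.1 + totalDeg deg l := by simp [totalDeg]

theorem monomial_cons (p : Σ i, W i) (l : List (Σ i, W i)) :
    monomial deg (p :: l) = gen deg p.1 p.2 * monomial deg l := by simp [monomial]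

/-- Each factor contributes at least `1` to `ε` times the total degree. This bounds the number of
factors of a monomial of given degree. -/
theorem length_le_totalDeg (h : IsLocallyFiniteDeg deg ε) (l : List (Σ i, W i)) :
    (l.length : ℤ) ≤ ε * totalDeg deg l := by
  induction l with
  | nil => simp [totalDeg]
  | cons p l ih =>
    have := h.pos p.1
    rw [totalDeg_cons, mul_add, List.length_cons]
    push_cast
    omega

theorem deg_le_totalDeg (h : IsLocallyFiniteDeg deg ε) (l : List (Σ i, W i)) :
    ∀ p ∈ l, ε * deg p.1 ≤ ε * totalDeg deg l := by
  induction l with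
  | nil => simp
  | cons q l ih =>
    intro p hp
    have h1 := length_le_totalDeg h l
    have h2 := h.pos q.1
    rw [totalDeg_cons, mul_add]
    rcases List.mem_cons.1 hp with rfl | hp
    · omega
    · have := ih p hp
      omega

/-- No factor of a monomial of degree `n` can exceed `n` in absolute degree, so the maps on higher
generators are never seen. This justifies truncating local trivializations to finitely many
generators. -/
theorem map_congr_of_mem_piece (h : IsLocallyFiniteDeg deg ε) {n : ℤ} {f g : ∀ i, W i →ₗ[ℝ] W' i}
    (hfg : ∀ i, ε * deg i ≤ ε * n → f i = g i) {z : GSym deg W} (hz : z ∈ piece deg W n) :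
    map deg f z = map deg g z := by
  induction hz using Submodule.span_induction with
  | mem x hx =>
    obtain ⟨l, rfl, rfl⟩ := hx
    simp only [monomial, map_list_prod, List.map_map]
    congr 1
    refine List.map_congr_left fun p hp => ?_
    simp [hfg p.1 (deg_le_totalDeg h l p hp)]
  | zero => simp
  | add x y _ _ hx hy => simp [hx, hy]
  | smul r x _ hx => simp [hx]

/-- Both the admissible generators and the lengths of the monomials are bounded, so a power of one
finite-dimensional subspace contains the whole part. -/
theorem finiteDimensional_piece (h : IsLocallyFiniteDeg deg ε) [∀ i, FiniteDimensional ℝ (W i)]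
    (n : ℤ) : FiniteDimensional ℝ (piece deg W n) := by
  -- Including `1` makes the powers of `B` increase, so that the shorter monomials also lie in the
  -- power with exponent `ε * n`.
  set B : Submodule ℝ (GSym deg W) :=
    1 ⊔ ⨆ i ∈ (h.finite (ε * n)).toFinset, LinearMap.range (gen deg i : W i →ₗ[ℝ] GSym deg W)
  have hB : B.FG := by
    refine Submodule.FG.sup (by
      rw [Submodule.one_eq_span]; exact Submodule.fg_span (Set.finite_singleton _)) ?_
    refine Submodule.fg_biSup _ _ fun i _ => ?_
    rw [LinearMap.range_eq_map]
    exact (Module.Finite.fg_top).map _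
  have h1 : (1 : Submodule ℝ (GSym deg W)) ≤ B := le_sup_left
  have hle : piece deg W n ≤ B ^ (ε * n).toNat := by
    refine Submodule.span_le.2 ?_
    rintro _ ⟨l, rfl, rfl⟩
    have hl := length_le_totalDeg h l
    have key : ∀ l' : List (Σ i, W i), (∀ p ∈ l', ε * deg p.1 ≤ ε * totalDeg deg l) →
        monomial deg l' ∈ B ^ l'.length := by
      intro l' hl'
      induction l' with
      | nil => 
        rw [List.length_nil, pow_zero]
        exact Submodule.one_le.1 (le_refl (1 : Submodule ℝ (GSym deg W)))
      | cons p l' ih =>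
        rw [monomial_cons, List.length_cons, pow_succ']
        refine Submodule.mul_mem_mul ?_ (ih fun q hq => hl' q (List.mem_cons_of_mem _ hq))
        refine Submodule.mem_sup_right ?_
        refine Submodule.mem_iSup_of_mem p.1 (Submodule.mem_iSup_of_mem ?_ ⟨p.2, rfl⟩)
        simpa using hl' p List.mem_cons_self
    exact pow_le_pow_right₀ h1 (by omega) (key l (deg_le_totalDeg h l))
  have : FiniteDimensional ℝ ↥(B ^ (ε * n).toNat) :=
    Module.Finite.iff_fg.2 (hB.pow _)
  exact Submodule.finiteDimensional_of_le hle

/-- The augmentation of the graded-symmetric algebra, which kills all generators. -/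
def augmentation (deg : ι → ℤ) (W : ι → Type*) [∀ i, AddCommGroup (W i)] [∀ i, Module ℝ (W i)] :
    GSym deg W →ₐ[ℝ] ℝ :=
  lift deg (fun _ => 0) (by simp)

@[simp]
theorem augmentation_gen (i : ι) (v : W i) : augmentation deg W (gen deg i v) = 0 := by
  simp [augmentation]

/-- By the length bound, the only monomial of degree `0` is the empty one. -/
theorem eq_algebraMap_of_mem_piece_zero (h : IsLocallyFiniteDeg deg ε) {z : GSym deg W}
    (hz : z ∈ piece deg W 0) : z = algebraMap ℝ _ (augmentation deg W z) := by
  induction hz using Submodule.span_induction with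
  | mem x hx =>
    obtain ⟨l, hl, rfl⟩ := hx
    have := length_le_totalDeg h l
    rw [hl, mul_zero] at this
    obtain rfl : l = [] := List.length_eq_zero_iff.1 (by omega)
    simp [monomial]
  | zero => simp
  | add x y _ _ hx hy => rw [map_add, map_add, ← hx, ← hy]
  | smul r x _ hx => rw [map_smul, Algebra.smul_def, smul_eq_mul, map_mul, ← hx]

/-- The factor `c` covers degree-preserving morphisms (`c = 1`) and degree-reversing ones (`c = -1`)
at once. -/
theorem lift_mem {A : Type*} [Ring A] [Algebra ℝ A] {𝒜 : ℤ → Submodule ℝ A}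
    [SetLike.GradedMonoid 𝒜] (c : ℤ) {f : ∀ i, W i →ₗ[ℝ] A}
    {hf : ∀ i j v w, f i v * f j w = koszulSign (deg i) (deg j) • (f j w * f i v)}
    (hmem : ∀ i v, f i v ∈ 𝒜 (c * deg i)) {n : ℤ} {z : GSym deg W} (hz : z ∈ piece deg W n) :
    lift deg f hf z ∈ 𝒜 (c * n) := by
  induction hz using Submodule.span_induction with
  | mem x hx =>
    obtain ⟨l, rfl, rfl⟩ := hx
    induction l with
    | nil => simpa [monomial, totalDeg] using SetLike.GradedOne.one_mem
    | cons p l ih =>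
      rw [monomial_cons, totalDeg_cons, mul_add, map_mul, lift_gen]
      exact SetLike.GradedMul.mul_mem (hmem _ _) ih
  | zero => simp
  | add x y _ _ hx hy => rw [map_add]; exact add_mem hx hy
  | smul r x _ hx => rw [map_smul]; exact Submodule.smul_mem _ _ hx

/-- The elements satisfying `P` form a subalgebra containing the generators. The universal property
lifts the generators into it, and by uniqueness the lift followed by the inclusion is the identity.
-/
theorem induction_gen {P : GSym deg W → Prop} (algebraMap : ∀ r, P (algebraMap ℝ _ r))
    (gen : ∀ i v, P (gen deg i v)) (add : ∀ a b, P a → P b → P (a + b))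
    (mul : ∀ a b, P a → P b → P (a * b)) (z : GSym deg W) : P z := by
  let S : Subalgebra ℝ (GSym deg W) :=
    { carrier := {z | P z}
      mul_mem' := fun ha hb => mul _ _ ha hb
      add_mem' := fun ha hb => add _ _ ha hb
      algebraMap_mem' := algebraMap }
  have hcomm : ∀ i j (v : W i) (w : W j), (⟨GSym.gen deg i v, gen i v⟩ : S) * ⟨_, gen j w⟩ =
      koszulSign (deg i) (deg j) • ((⟨_, gen j w⟩ : S) * ⟨_, gen i v⟩) := fun i j v w =>
    Subtype.ext (gen_mul_gen deg i j v w)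
  let F : GSym deg W →ₐ[ℝ] S :=
    lift deg (fun i => (GSym.gen deg i).codRestrict (Subalgebra.toSubmodule S) (gen i)) hcomm
  have hF : S.val.comp F = AlgHom.id ℝ _ := algHom_ext deg fun i v => by
    exact congrArg Subtype.val (lift_gen deg _ hcomm i v)
  have := (F z).2
  rwa [show ((F z : S) : GSym deg W) = z from DFunLike.congr_fun hF z] at this

/-- A family of linear maps induces an algebra morphism between the graded-symmetric algebras for
opposite degree functions. -/
def mapNeg (deg : ι → ℤ) {deg' : ι → ℤ} (hdeg : ∀ i, deg' i = -deg i) (f : ∀ i, W i →ₗ[ℝ] W' i) :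
    GSym deg W →ₐ[ℝ] GSym deg' W' :=
  lift deg (fun i => gen deg' i ∘ₗ f i) fun i j v w => by
    -- The sign depends only on the product of the two degrees, which is unchanged when both are
    -- negated.
    have h : koszulSign (deg i) (deg j) = koszulSign (deg' i) (deg' j) := by
      simp [koszulSign, hdeg]
    rw [h]
    exact gen_mul_gen deg' i j (f i v) (f j w)

variable {deg' : ι → ℤ}

@[simp]
theorem mapNeg_gen (hdeg : ∀ i, deg' i = -deg i) (f : ∀ i, W i →ₗ[ℝ] W' i) (i : ι) (v : W i) :
    mapNeg deg hdeg f (gen deg i v) = gen deg' i (f i v) := by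
  simp [mapNeg]

theorem mapNeg_mem (hdeg : ∀ i, deg' i = -deg i) (f : ∀ i, W i →ₗ[ℝ] W' i) {n : ℤ}
    {z : GSym deg W} (hz : z ∈ piece deg W n) : mapNeg deg hdeg f z ∈ piece deg' W' (-n) := by
  have := lift_mem (𝒜 := piece deg' W') (-1) (f := fun i => gen deg' i ∘ₗ f i)
    (hf := fun i j v w => by
      rw [show koszulSign (deg i) (deg j) = koszulSign (deg' i) (deg' j) by simp [koszulSign, hdeg]]
      exact gen_mul_gen deg' i j (f i v) (f j w))
    (fun i v => by simpa [hdeg i] using gen_mem deg' i (f i v)) hz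
  rwa [neg_one_mul] at this

/-- The graded-symmetric algebras of isomorphic graded vector spaces for opposite degree functions
have isomorphic homogeneous parts in opposite degrees. -/
def pieceNegEquiv (hdeg : ∀ i, deg' i = -deg i) (f : ∀ i, W i ≃ₗ[ℝ] W' i) (n : ℤ) :
    piece deg W n ≃ₗ[ℝ] piece deg' W' (-n) := by
  have hdeg' : ∀ i, deg i = -deg' i := fun i => by rw [hdeg, neg_neg]
  have h1 : (mapNeg deg' hdeg' fun i => ((f i).symm : W' i →ₗ[ℝ] W i)).comp
      (mapNeg deg hdeg fun i => (f i : W i →ₗ[ℝ] W' i)) = AlgHom.id ℝ _ :=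
    algHom_ext deg (by simp)
  have h2 : (mapNeg deg hdeg fun i => (f i : W i →ₗ[ℝ] W' i)).comp
      (mapNeg deg' hdeg' fun i => ((f i).symm : W' i →ₗ[ℝ] W i)) = AlgHom.id ℝ _ :=
    algHom_ext deg' (by simp)
  exact LinearEquiv.ofLinearMap
    ((mapNeg deg hdeg fun i => (f i : W i →ₗ[ℝ] W' i)).toLinearMap.restrict
      fun z hz => mapNeg_mem hdeg _ hz)
    ((mapNeg deg' hdeg' fun i => ((f i).symm : W' i →ₗ[ℝ] W i)).toLinearMap.restrict
      fun z hz => by simpa using mapNeg_mem hdeg' _ hz)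
    (LinearMap.ext fun z => Subtype.ext (DFunLike.congr_fun h2 z.1))
    (LinearMap.ext fun z => Subtype.ext (DFunLike.congr_fun h1 z.1))

end GSym

end GSymLemmas

/-! ### Smoothness for functions with values in an algebra without topology -/

section CoefficientSmooth

variable {EM : Type*} [NormedAddCommGroup EM] [NormedSpace ℝ EM]
  {HM : Type*} [TopologicalSpace HM] (I : ModelWithCorners ℝ EM HM)
  {M : Type*} [TopologicalSpace M] [ChartedSpace HM M]
  (A : Type*) [Ring A] [Algebra ℝ A]

/-- The functions with values in a real algebra `A` that are near `x₀` finite linear combinations of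
elements of `A` with coefficients that are smooth at `x₀`. -/
def coeffSmoothAt (x₀ : M) : Subalgebra ℝ (M → A) where
  carrier := {h | ∃ t ∈ Submodule.span ℝ {g : M → A | ∃ (c : M → ℝ) (a : A),
    ContMDiffAt I 𝓘(ℝ) ∞ c x₀ ∧ g = fun x => c x • a}, ∀ᶠ x in 𝓝 x₀, h x = t x}
  mul_mem' := by
    rintro a b ⟨t, ht, hat⟩ ⟨u, hu, hbu⟩
    refine ⟨t * u, ?_, ?_⟩
    · have h := Submodule.mul_mem_mul ht hu
      rw [Submodule.span_mul_span] at h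
      refine Submodule.span_mono ?_ h
      rintro _ ⟨_, ⟨c, a, hc, rfl⟩, _, ⟨d, b, hd, rfl⟩, rfl⟩
      refine ⟨c * d, a * b, hc.mul hd, ?_⟩
      funext x
      simp [mul_smul, smul_comm (d x) (c x)]
    · filter_upwards [hat, hbu] with x h1 h2
      simp [h1, h2]
  add_mem' := by
    rintro a b ⟨t, ht, hat⟩ ⟨u, hu, hbu⟩
    refine ⟨t + u, add_mem ht hu, ?_⟩
    filter_upwards [hat, hbu] with x h1 h2
    simp [h1, h2]
  algebraMap_mem' r := ⟨_, Submodule.subset_span ⟨fun _ => r, 1, contMDiffAt_const, rfl⟩,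
    Filter.Eventually.of_forall fun x => by simp [Algebra.algebraMap_eq_smul_one]⟩

variable {I A}

theorem smul_mem_coeffSmoothAt {x₀ : M} {c : M → ℝ} (hc : ContMDiffAt I 𝓘(ℝ) ∞ c x₀) (a : A) :
    (fun x => c x • a) ∈ coeffSmoothAt I A x₀ :=
  ⟨_, Submodule.subset_span ⟨c, a, hc, rfl⟩, Filter.Eventually.of_forall fun _ => rfl⟩

theorem coeffSmoothAt_congr {x₀ : M} {h h' : M → A} (hh : ∀ᶠ x in 𝓝 x₀, h x = h' x)
    (H : h' ∈ coeffSmoothAt I A x₀) : h ∈ coeffSmoothAt I A x₀ := by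
  obtain ⟨t, ht, hat⟩ := H
  exact ⟨t, ht, by filter_upwards [hh, hat] with x h1 h2; rw [h1, h2]⟩

/-- Expanding `c` in a basis of the finite-dimensional space `V` exhibits the coefficients. -/
theorem comp_linearMap_mem_coeffSmoothAt {x₀ : M} {V : Type*} [NormedAddCommGroup V]
    [NormedSpace ℝ V] [FiniteDimensional ℝ V] (ℓ : V →ₗ[ℝ] A) {c : M → V}
    (hc : ContMDiffAt I 𝓘(ℝ, V) ∞ c x₀) : (fun x => ℓ (c x)) ∈ coeffSmoothAt I A x₀ := by
  let b := Module.finBasis ℝ V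
  have h : (fun x => ℓ (c x)) = ∑ j, fun x => (b.coord j).toContinuousLinearMap (c x) • ℓ (b j) := by
    funext x
    rw [Finset.sum_apply]
    conv_lhs => rw [← b.sum_repr (c x), map_sum]
    simp
  rw [h]
  refine sum_mem fun j _ => smul_mem_coeffSmoothAt ?_ _
  exact (ContinuousLinearMap.contMDiff _).contMDiffAt.comp x₀ hc

/-- No continuity of `ℓ` is needed: it acts only on the constant vectors of a finite combination,
leaving the smooth coefficients alone. -/
theorem contMDiffAt_of_mem_coeffSmoothAt {x₀ : M} {V : Type*} [NormedAddCommGroup V]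
    [NormedSpace ℝ V] (ℓ : A →ₗ[ℝ] V) {h : M → A} (hh : h ∈ coeffSmoothAt I A x₀) :
    ContMDiffAt I 𝓘(ℝ, V) ∞ (fun x => ℓ (h x)) x₀ := by
  obtain ⟨t, ht, hht⟩ := hh
  have key : ContMDiffAt I 𝓘(ℝ, V) ∞ (fun x => ℓ (t x)) x₀ := by
    clear hht
    induction ht using Submodule.span_induction with
    | mem g hg =>
      obtain ⟨c, a, hc, rfl⟩ := hg
      simp only [map_smul]
      exact hc.smul contMDiffAt_const
    | zero => simpa using contMDiffAt_const
    | add g g' _ _ hg hg' => simp only [Pi.add_apply, map_add]; exact hg.add hg'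
    | smul r g _ hg => simp only [Pi.smul_apply, map_smul]; exact (contMDiffAt_const (c := r) (I := I) (I' := 𝓘(ℝ))).smul hg
  refine key.congr_of_eventuallyEq ?_
  filter_upwards [hht] with x hx
  rw [hx]

end CoefficientSmooth

/-! ### Local trivializations of the bundle of graded-symmetric algebras -/

section LocalTrivialization

variable {ι : Type*} [DecidableEq ι] (deg : ι → ℤ) (ε : ℤ)
  {EM : Type*} [NormedAddCommGroup EM] [NormedSpace ℝ EM]
  {HM : Type*} [TopologicalSpace HM] (I : ModelWithCorners ℝ EM HM)
  {M : Type*} [TopologicalSpace M] [ChartedSpace HM M]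
  (F : ι → Type*) [∀ i, NormedAddCommGroup (F i)] [∀ i, NormedSpace ℝ (F i)]
  (E : ι → M → Type*) [∀ i, TopologicalSpace (TotalSpace (F i) (E i))]
  [∀ i x, AddCommGroup (E i x)] [∀ i x, Module ℝ (E i x)] [∀ i x, TopologicalSpace (E i x)]
  [∀ i, FiberBundle (F i) (E i)] [∀ i, VectorBundle ℝ (F i) (E i)]

/-- The points at which the local trivializations around `x₀` of all generators whose degrees are
bounded by `n` are defined. -/
def symBaseSet (n : ℤ) (x₀ : M) : Set M :=
  {x | ∀ i, ε * deg i ≤ ε * n → x ∈ (trivializationAt (F i) (E i) x₀).baseSet}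

variable {deg ε} in
-- Local finiteness turns the intersection of base sets into a finite one; over all generators it
-- need not be open.
theorem isOpen_symBaseSet (h : IsLocallyFiniteDeg deg ε) (n : ℤ) (x₀ : M) :
    IsOpen (symBaseSet deg ε F E n x₀) := by
  have : symBaseSet deg ε F E n x₀ =
      ⋂ i ∈ {i | ε * deg i ≤ ε * n}, (trivializationAt (F i) (E i) x₀).baseSet := by
    ext x
    simp [symBaseSet]
  rw [this]
  exact (h.finite _).isOpen_biInter fun i _ => (trivializationAt (F i) (E i) x₀).open_baseSet

theorem mem_symBaseSet (n : ℤ) (x₀ : M) : x₀ ∈ symBaseSet deg ε F E n x₀ :=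
  fun _ _ => mem_baseSet_trivializationAt _ _ _

/-- The local trivialization around `x₀` of the bundle of graded-symmetric algebras in degrees
bounded by `n`. -/
def symToModel (n : ℤ) (x₀ x : M) : GSym deg (fun i => E i x) →ₐ[ℝ] GSym deg F :=
  GSym.map deg fun i => if ε * deg i ≤ ε * n then
    (trivializationAt (F i) (E i) x₀).linearMapAt ℝ x else 0

/-- The inverse of the local trivialization `symToModel`. -/
def symOfModel (n : ℤ) (x₀ x : M) : GSym deg F →ₐ[ℝ] GSym deg (fun i => E i x) :=
  GSym.map deg fun i => if ε * deg i ≤ ε * n then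
    (trivializationAt (F i) (E i) x₀).symmₗ ℝ x else 0

variable {deg ε E F I}

/-- On generators within the bound the two maps are inverse trivializations. Those beyond it are
sent to zero but do not occur in degree `n`. -/
theorem symOfModel_symToModel (h : IsLocallyFiniteDeg deg ε) {n : ℤ} {x₀ x : M}
    (hx : x ∈ symBaseSet deg ε F E n x₀) {z : GSym deg (fun i => E i x)}
    (hz : z ∈ GSym.piece deg (fun i => E i x) n) :
    symOfModel deg ε F E n x₀ x (symToModel deg ε F E n x₀ x z) = z := by
  rw [symOfModel, symToModel, ← AlgHom.comp_apply, ← GSym.map_comp]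
  refine (GSym.map_congr_of_mem_piece h (g := fun i => LinearMap.id) ?_ hz).trans
    (DFunLike.congr_fun (GSym.map_id deg) z)
  intro i hi
  ext v
  simp only [if_pos hi, LinearMap.comp_apply]
  exact (trivializationAt (F i) (E i) x₀).symmₗ_linearMapAt (hx i hi) v

theorem symToModel_symOfModel (h : IsLocallyFiniteDeg deg ε) {n : ℤ} {x₀ x : M}
    (hx : x ∈ symBaseSet deg ε F E n x₀) {a : GSym deg F} (ha : a ∈ GSym.piece deg F n) :
    symToModel deg ε F E n x₀ x (symOfModel deg ε F E n x₀ x a) = a := by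
  rw [symOfModel, symToModel, ← AlgHom.comp_apply, ← GSym.map_comp]
  refine (GSym.map_congr_of_mem_piece h (g := fun i => LinearMap.id) ?_ ha).trans
    (DFunLike.congr_fun (GSym.map_id deg) a)
  intro i hi
  ext v
  simp only [if_pos hi, LinearMap.comp_apply]
  exact (trivializationAt (F i) (E i) x₀).linearMapAt_symmₗ (hx i hi) v

/-- A subalgebra of sections that contains the local frames contains the constant sections with
respect to the local trivialization `symOfModel`. -/
theorem symOfModel_mem (S : Subalgebra ℝ (∀ x, GSym deg (fun i => E i x))) (n : ℤ) (x₀ : M)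
    (hS : ∀ i, ε * deg i ≤ ε * n → ∀ v, (fun x => GSym.gen deg (W := fun i => E i x) i
      ((trivializationAt (F i) (E i) x₀).symmₗ ℝ x v)) ∈ S) (a : GSym deg F) :
    (fun x => symOfModel deg ε F E n x₀ x a) ∈ S := by
  induction a using GSym.induction_gen with
  | algebraMap r => simp only [AlgHom.commutes]; exact S.algebraMap_mem r
  | gen i v =>
    by_cases hi : ε * deg i ≤ ε * n
    · simpa [symOfModel, hi] using hS i hi v
    · simp only [symOfModel, GSym.map_gen, hi, if_false, LinearMap.zero_apply, map_zero]
      exact S.zero_mem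
  | add a b ha hb => simp only [map_add]; exact S.add_mem ha hb
  | mul a b ha hb => simp only [map_mul]; exact S.mul_mem ha hb

theorem algebraMap_mem_symSmoothAt {x₀ : M} {f : M → ℝ} (hf : ContMDiffAt I 𝓘(ℝ) ∞ f x₀) :
    (fun x => algebraMap ℝ _ (f x)) ∈ symSmoothAt deg I F E x₀ :=
  ⟨_, Algebra.subset_adjoin (Or.inl ⟨f, hf, rfl⟩), Filter.Eventually.of_forall fun _ => rfl⟩

theorem gen_mem_symSmoothAt {x₀ : M} {i : ι} {σ : ∀ x, E i x}
    (hσ : ContMDiffAt I (I.prod 𝓘(ℝ, F i)) ∞ (fun x => TotalSpace.mk' (F i) x (σ x)) x₀) :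
    (fun x => GSym.gen deg (W := fun i => E i x) i (σ x)) ∈ symSmoothAt deg I F E x₀ :=
  ⟨_, Algebra.subset_adjoin (Or.inr ⟨i, σ, hσ, rfl⟩), Filter.Eventually.of_forall fun _ => rfl⟩

theorem symSmoothAt_congr {x₀ : M} {s s' : ∀ x, GSym deg (fun i => E i x)}
    (hh : ∀ᶠ x in 𝓝 x₀, s x = s' x) (H : s' ∈ symSmoothAt deg I F E x₀) :
    s ∈ symSmoothAt deg I F E x₀ := by
  obtain ⟨t, ht, hat⟩ := H
  exact ⟨t, ht, by filter_upwards [hh, hat] with x h1 h2; rw [h1, h2]⟩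

variable [∀ i, ContMDiffVectorBundle ∞ (F i) (E i) I]

theorem contMDiffAt_symmₗ {i : ι} {x₀ x₁ : M}
    (hx : x₁ ∈ (trivializationAt (F i) (E i) x₀).baseSet) (v : F i) :
    ContMDiffAt I (I.prod 𝓘(ℝ, F i)) ∞ (fun x => TotalSpace.mk' (F i) x
      ((trivializationAt (F i) (E i) x₀).symmₗ ℝ x v)) x₁ := by
  rw [Trivialization.contMDiffAt_section_iff (trivializationAt (F i) (E i) x₀) hx]
  refine (contMDiffAt_const (c := v)).congr_of_eventuallyEq ?_
  filter_upwards [(trivializationAt (F i) (E i) x₀).open_baseSet.mem_nhds hx] with x hx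
  rw [Trivialization.symmₗ_apply _ hx, Trivialization.apply_mk_symm _ hx]

theorem symOfModel_mem_symSmoothAt {n : ℤ} {x₀ x₁ : M}
    (hx : x₁ ∈ symBaseSet deg ε F E n x₀) (a : GSym deg F) :
    (fun x => symOfModel deg ε F E n x₀ x a) ∈ symSmoothAt deg I F E x₁ :=
  symOfModel_mem _ n x₀ (fun i hi v => gen_mem_symSmoothAt (contMDiffAt_symmₗ (hx i hi) v)) a

theorem symOfModel_coeff_mem_symSmoothAt {n : ℤ} {x₀ x₁ : M}
    (hx : x₁ ∈ symBaseSet deg ε F E n x₀) {c : M → GSym deg F}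
    (hc : c ∈ coeffSmoothAt I (GSym deg F) x₁) :
    (fun x => symOfModel deg ε F E n x₀ x (c x)) ∈ symSmoothAt deg I F E x₁ := by
  obtain ⟨t, ht, hct⟩ := hc
  refine symSmoothAt_congr (s' := fun x => symOfModel deg ε F E n x₀ x (t x))
    (by filter_upwards [hct] with x hx; rw [hx]) ?_
  clear hct
  induction ht using Submodule.span_induction with
  | mem g hg =>
    obtain ⟨c, a, hc, rfl⟩ := hg
    simp only [Algebra.smul_def, map_mul, AlgHom.commutes]
    exact mul_mem (algebraMap_mem_symSmoothAt hc) (symOfModel_mem_symSmoothAt hx a)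
  | zero => simp only [Pi.zero_apply, map_zero]; exact zero_mem (symSmoothAt deg I F E x₁)
  | add g g' _ _ hg hg' => simp only [Pi.add_apply, map_add]; exact add_mem hg hg'
  | smul r g _ hg => simp only [Pi.smul_apply, map_smul]; exact Subalgebra.smul_mem _ hg r

/-- It suffices to treat elementary sections: a function multiplies `1`, a section of a bundle
within the bound becomes the generator of its smooth coordinates, and one beyond the bound becomes
zero. -/
theorem symToModel_mem_coeffSmoothAt [∀ i, FiniteDimensional ℝ (F i)] {n : ℤ} {x₀ x₁ : M}
    (hx : x₁ ∈ symBaseSet deg ε F E n x₀) {s : ∀ x, GSym deg (fun i => E i x)}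
    (hs : s ∈ symSmoothAt deg I F E x₁) :
    (fun x => symToModel deg ε F E n x₀ x (s x)) ∈ coeffSmoothAt I (GSym deg F) x₁ := by
  obtain ⟨t, ht, hst⟩ := hs
  refine coeffSmoothAt_congr (h' := fun x => symToModel deg ε F E n x₀ x (t x))
    (by filter_upwards [hst] with x hx; rw [hx]) ?_
  clear hst
  induction ht using Algebra.adjoin_induction with
  | mem t ht =>
    obtain ⟨f, hf, rfl⟩ | ⟨i, σ, hσ, rfl⟩ := ht
    · simpa [Algebra.algebraMap_eq_smul_one] using smul_mem_coeffSmoothAt hf (1 : GSym deg F)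
    · by_cases hi : ε * deg i ≤ ε * n
      · rw [Trivialization.contMDiffAt_section_iff _ (hx i hi)] at hσ
        refine coeffSmoothAt_congr ?_ (comp_linearMap_mem_coeffSmoothAt (GSym.gen deg i) hσ)
        filter_upwards [(trivializationAt (F i) (E i) x₀).open_baseSet.mem_nhds (hx i hi)] with x hx
        simp [symToModel, hi, Trivialization.linearMapAt_apply, hx]
      · simp only [symToModel, GSym.map_gen, hi, if_false, LinearMap.zero_apply, map_zero]
        exact zero_mem (coeffSmoothAt I (GSym deg F) x₁)
  | algebraMap r =>
    simp only [Pi.algebraMap_apply, AlgHom.commutes]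
    exact Subalgebra.algebraMap_mem (coeffSmoothAt I (GSym deg F) x₁) r
  | add g g' _ _ hg hg' => simp only [Pi.add_apply, map_add]; exact add_mem hg hg'
  | mul g g' _ _ hg hg' => simp only [Pi.mul_apply, map_mul]; exact mul_mem hg hg'

end LocalTrivialization

/-! ### The homogeneous parts as smooth vector bundles -/

section SymPrebundle

variable {ι : Type*} [DecidableEq ι] {deg : ι → ℤ} {ε : ℤ}
  {EM : Type*} [NormedAddCommGroup EM] [NormedSpace ℝ EM]
  {HM : Type*} [TopologicalSpace HM] (I : ModelWithCorners ℝ EM HM)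
  {M : Type*} [TopologicalSpace M] [ChartedSpace HM M]
  (F : ι → Type*) [∀ i, NormedAddCommGroup (F i)] [∀ i, NormedSpace ℝ (F i)]
  [∀ i, FiniteDimensional ℝ (F i)]
  (E : ι → M → Type*) [∀ i, TopologicalSpace (TotalSpace (F i) (E i))]
  [∀ i x, AddCommGroup (E i x)] [∀ i x, Module ℝ (E i x)] [∀ i x, TopologicalSpace (E i x)]
  [∀ i, FiberBundle (F i) (E i)] [∀ i, VectorBundle ℝ (F i) (E i)]

/-- The rank of the part of degree `n` of the bundle of graded-symmetric algebras. -/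
def symRank (deg : ι → ℤ) (n : ℤ) : ℕ := Module.finrank ℝ (GSym.piece deg F n)

/-- Linear coordinates on the part of degree `n` of the model graded-symmetric algebra. -/
def symModelEquiv (h : IsLocallyFiniteDeg deg ε) (n : ℤ) :
    GSym.piece deg F n ≃ₗ[ℝ] EuclideanSpace ℝ (Fin (symRank F deg n)) :=
  have := GSym.finiteDimensional_piece h (W := F) n
  LinearEquiv.ofFinrankEq _ _ (by rw [finrank_euclideanSpace_fin]; rfl)

/-- The fibre of the part of degree `n` of the bundle of graded-symmetric algebras. -/
@[nolint unusedArguments]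
def SymFiber (_F : ι → Type*) (E : ι → M → Type*) [∀ i x, AddCommGroup (E i x)]
    [∀ i x, Module ℝ (E i x)] (_h : IsLocallyFiniteDeg deg ε) (n : ℤ) (x : M) : Type _ :=
  GSym.piece deg (fun i => E i x) n

variable (h : IsLocallyFiniteDeg deg ε) (n : ℤ)

instance (x : M) : AddCommGroup (SymFiber F E h n x) :=
  inferInstanceAs (AddCommGroup (GSym.piece deg (fun i => E i x) n))

instance (x : M) : Module ℝ (SymFiber F E h n x) :=
  inferInstanceAs (Module ℝ (GSym.piece deg (fun i => E i x) n))

/-- The fibre `SymFiber` is a homogeneous part of the graded-symmetric algebra. -/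
def symFiberEquiv (x : M) : GSym.piece deg (fun i => E i x) n ≃ₗ[ℝ] SymFiber F E h n x :=
  LinearEquiv.refl ℝ _

variable {E} in
/-- The inclusion of the fibre in the graded-symmetric algebra. -/
def symFiberIncl (x : M) : SymFiber F E h n x →ₗ[ℝ] GSym deg (fun i => E i x) :=
  (GSym.piece deg (fun i => E i x) n).subtype ∘ₗ (symFiberEquiv F E h n x).symm

/-- The coordinates around `x₀` of the part of degree `n`. -/
def symCoord (x₀ x : M) : SymFiber F E h n x →ₗ[ℝ] EuclideanSpace ℝ (Fin (symRank F deg n)) :=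
  (symModelEquiv F h n).toLinearMap ∘ₗ
    ((symToModel deg ε F E n x₀ x).toLinearMap.restrict fun _ hz => GSym.map_mem deg _ hz) ∘ₗ
    (symFiberEquiv F E h n x).symm.toLinearMap

/-- The element of the fibre with given coordinates around `x₀`. -/
def symOfCoord (x₀ x : M) : EuclideanSpace ℝ (Fin (symRank F deg n)) →ₗ[ℝ] SymFiber F E h n x :=
  (symFiberEquiv F E h n x).toLinearMap ∘ₗ
    ((symOfModel deg ε F E n x₀ x).toLinearMap.restrict fun _ hz => GSym.map_mem deg _ hz) ∘ₗ
    (symModelEquiv F h n).symm.toLinearMap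

theorem symCoord_apply (x₀ x : M) (z : SymFiber F E h n x) : symCoord F E h n x₀ x z =
    symModelEquiv F h n ⟨symToModel deg ε F E n x₀ x (symFiberIncl F h n x z),
      GSym.map_mem deg _ (Subtype.prop _)⟩ := rfl

theorem symFiberIncl_symOfCoord (x₀ x : M) (v : EuclideanSpace ℝ (Fin (symRank F deg n))) :
    symFiberIncl F h n x (symOfCoord F E h n x₀ x v) =
      symOfModel deg ε F E n x₀ x ((symModelEquiv F h n).symm v) := rfl

theorem symFiberIncl_injective (x : M) : Function.Injective (symFiberIncl F (E := E) h n x) :=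
  Subtype.val_injective

theorem symOfCoord_symCoord {x₀ x : M} (hx : x ∈ symBaseSet deg ε F E n x₀)
    (z : SymFiber F E h n x) : symOfCoord F E h n x₀ x (symCoord F E h n x₀ x z) = z := by
  apply symFiberIncl_injective
  rw [symFiberIncl_symOfCoord, symCoord_apply, LinearEquiv.symm_apply_apply]
  exact symOfModel_symToModel h hx (Subtype.prop _)

theorem symCoord_symOfCoord {x₀ x : M} (hx : x ∈ symBaseSet deg ε F E n x₀)
    (v : EuclideanSpace ℝ (Fin (symRank F deg n))) :
    symCoord F E h n x₀ x (symOfCoord F E h n x₀ x v) = v := by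
  rw [symCoord_apply, ← LinearEquiv.eq_symm_apply]
  apply Subtype.ext
  simp only [symFiberIncl_symOfCoord]
  exact symToModel_symOfModel h hx (Subtype.prop _)

/-- The local trivialization around `x₀` of the part of degree `n`. -/
def symPretrivialization (x₀ : M) : Pretrivialization (EuclideanSpace ℝ (Fin (symRank F deg n)))
    (π (EuclideanSpace ℝ (Fin (symRank F deg n))) (SymFiber F E h n)) where
  toFun p := (p.1, symCoord F E h n x₀ p.1 p.2)
  invFun q := ⟨q.1, symOfCoord F E h n x₀ q.1 q.2⟩
  source := TotalSpace.proj ⁻¹' symBaseSet deg ε F E n x₀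
  target := symBaseSet deg ε F E n x₀ ×ˢ Set.univ
  map_source' p hp := ⟨hp, trivial⟩
  map_target' q hq := hq.1
  left_inv' p hp := by
    obtain ⟨x, z⟩ := p
    exact congrArg (TotalSpace.mk x) (symOfCoord_symCoord F E h n hp z)
  right_inv' q hq := by
    obtain ⟨x, v⟩ := q
    exact congrArg (Prod.mk x) (symCoord_symOfCoord F E h n hq.1 v)
  open_target := (isOpen_symBaseSet F E h n x₀).prod isOpen_univ
  baseSet := symBaseSet deg ε F E n x₀
  open_baseSet := isOpen_symBaseSet F E h n x₀
  source_eq := rfl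
  target_eq := rfl
  proj_toFun _ _ := rfl

theorem symPretrivialization_symm {x₀ x : M} (hx : x ∈ symBaseSet deg ε F E n x₀)
    (v : EuclideanSpace ℝ (Fin (symRank F deg n))) :
    (symPretrivialization F E h n x₀).symm x v = symOfCoord F E h n x₀ x v :=
  (Pretrivialization.symm_apply (symPretrivialization F E h n x₀) hx v).trans rfl

/-- The coordinate change from coordinates around `x₀` to coordinates around `x₁`. -/
def symCoordChange (x₀ x₁ x : M) : EuclideanSpace ℝ (Fin (symRank F deg n)) →L[ℝ]
    EuclideanSpace ℝ (Fin (symRank F deg n)) :=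
  LinearMap.toContinuousLinearMap (symCoord F E h n x₁ x ∘ₗ symOfCoord F E h n x₀ x)

variable {I F} in
-- An operator on a Euclidean space is the sum of the coordinate functionals tensored with its
-- values on the standard basis.
theorem ContMDiffAt.of_apply_basis {r : ℕ} {V : Type*} [NormedAddCommGroup V] [NormedSpace ℝ V]
    {x₀ : M} {G : M → EuclideanSpace ℝ (Fin r) →L[ℝ] V}
    (hG : ∀ v, ContMDiffAt I 𝓘(ℝ, V) ∞ (fun x => G x v) x₀) :
    ContMDiffAt I 𝓘(ℝ, EuclideanSpace ℝ (Fin r) →L[ℝ] V) ∞ G x₀ := by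
  have hsum : G = fun x => ∑ i, ContinuousLinearMap.smulRightL ℝ _ _
      (EuclideanSpace.proj i : EuclideanSpace ℝ (Fin r) →L[ℝ] ℝ)
      (G x (EuclideanSpace.single i 1)) := by
    funext x
    ext v
    conv_lhs => rw [← (EuclideanSpace.basisFun (Fin r) ℝ).sum_repr v]
    simp
  rw [hsum]
  exact ContMDiffAt.sum fun i _ => (ContinuousLinearMap.contMDiff _).contMDiffAt.comp x₀ (hG _)

theorem contMDiffAt_symCoord [∀ i, ContMDiffVectorBundle ∞ (F i) (E i) I] {x₀ x₁ : M}
    (hx : x₁ ∈ symBaseSet deg ε F E n x₀) {s : ∀ x, SymFiber F E h n x}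
    (hs : (fun x => symFiberIncl F h n x (s x)) ∈ symSmoothAt deg I F E x₁) :
    ContMDiffAt I 𝓘(ℝ, EuclideanSpace ℝ (Fin (symRank F deg n))) ∞
      (fun x => symCoord F E h n x₀ x (s x)) x₁ := by
  -- The summands with smooth coefficients need not lie in degree `n`, so the coordinates are first
  -- extended to the whole algebra by the projection to degree `n`.
  have h1 := contMDiffAt_of_mem_coeffSmoothAt ((symModelEquiv F h n).toLinearMap ∘ₗ
    (GradedAlgebra.proj (GSym.piece deg F) n).codRestrict _ fun z => by
      rw [GradedAlgebra.proj_apply]; exact Subtype.prop _) (symToModel_mem_coeffSmoothAt hx hs)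
  refine h1.congr_of_eventuallyEq (Filter.Eventually.of_forall fun x => ?_)
  simp only [symCoord_apply, LinearMap.comp_apply, LinearEquiv.coe_coe]
  congr 1
  apply Subtype.ext
  simp only [LinearMap.codRestrict_apply, GradedAlgebra.proj_apply]
  exact (DirectSum.decompose_of_mem_same _ (GSym.map_mem deg _ (Subtype.prop _))).symm

theorem symOfCoord_mem_symSmoothAt [∀ i, ContMDiffVectorBundle ∞ (F i) (E i) I] {x₀ x₁ : M}
    (hx : x₁ ∈ symBaseSet deg ε F E n x₀) {c : M → EuclideanSpace ℝ (Fin (symRank F deg n))}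
    (hc : ContMDiffAt I 𝓘(ℝ, EuclideanSpace ℝ (Fin (symRank F deg n))) ∞ c x₁) :
    (fun x => symFiberIncl F h n x (symOfCoord F E h n x₀ x (c x))) ∈ symSmoothAt deg I F E x₁ :=
  symOfModel_coeff_mem_symSmoothAt hx (comp_linearMap_mem_coeffSmoothAt
    ((GSym.piece deg F n).subtype ∘ₗ (symModelEquiv F h n).symm.toLinearMap) hc)

/-- Applied to a constant vector, the coordinate change gives the coordinates around `x₁` of a
section that is constant around `x₀`, hence smooth. -/
theorem contMDiffOn_symCoordChange [∀ i, ContMDiffVectorBundle ∞ (F i) (E i) I] (x₀ x₁ : M) :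
    ContMDiffOn I 𝓘(ℝ, EuclideanSpace ℝ (Fin (symRank F deg n)) →L[ℝ]
      EuclideanSpace ℝ (Fin (symRank F deg n))) ∞ (symCoordChange F E h n x₀ x₁)
      (symBaseSet deg ε F E n x₀ ∩ symBaseSet deg ε F E n x₁) := by
  intro x hx
  refine (ContMDiffAt.of_apply_basis fun v => ?_).contMDiffWithinAt
  exact contMDiffAt_symCoord I F E h n hx.2
    (symOfCoord_mem_symSmoothAt I F E h n hx.1 contMDiffAt_const)

/-- The coordinates centred at `x` itself are those of the preferred trivialization at `x`, so the
inducing condition of the prebundle holds by definition. -/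
instance (x : M) : TopologicalSpace (SymFiber F E h n x) :=
  .induced (symCoord F E h n x x) inferInstance

/-- The vector prebundle structure on the part of degree `n` of the bundle of graded-symmetric
algebras. -/
def symPrebundle [∀ i, ContMDiffVectorBundle ∞ (F i) (E i) I] :
    VectorPrebundle ℝ (EuclideanSpace ℝ (Fin (symRank F deg n))) (SymFiber F E h n) where
  pretrivializationAtlas := Set.range (symPretrivialization F E h n)
  pretrivialization_linear' := by
    rintro _ ⟨x₀, rfl⟩
    exact ⟨fun x _ => ⟨(symCoord F E h n x₀ x).map_add, (symCoord F E h n x₀ x).map_smul⟩⟩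
  pretrivializationAt := symPretrivialization F E h n
  mem_base_pretrivializationAt := mem_symBaseSet deg ε F E n
  pretrivialization_mem_atlas x := ⟨x, rfl⟩
  exists_coordChange := by
    rintro _ ⟨x₀, rfl⟩ _ ⟨x₁, rfl⟩
    refine ⟨symCoordChange F E h n x₀ x₁,
      (contMDiffOn_symCoordChange I F E h n x₀ x₁).continuousOn, fun x hx v => ?_⟩
    rw [symPretrivialization_symm F E h n hx.1]
    rfl
  totalSpaceMk_isInducing x := by
    have h2 : Topology.IsInducing (symCoord F E h n x x) := ⟨rfl⟩
    exact (Topology.isInducing_const_prod (x := x)).2 h2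

instance [∀ i, ContMDiffVectorBundle ∞ (F i) (E i) I] :
    (symPrebundle I F E h n).IsContMDiff I ∞ where
  exists_contMDiffCoordChange := by
    rintro _ ⟨x₀, rfl⟩ _ ⟨x₁, rfl⟩
    refine ⟨symCoordChange F E h n x₀ x₁, contMDiffOn_symCoordChange I F E h n x₀ x₁,
      fun x hx v => ?_⟩
    rw [symPretrivialization_symm F E h n hx.1]
    rfl

/-- The vector bundle smoothness of sections of the part of degree `n` agrees with `symSmoothAt`. -/
theorem contMDiffAt_symSection_iff [∀ i, ContMDiffVectorBundle ∞ (F i) (E i) I]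
    (s : ∀ x, SymFiber F E h n x) (x₀ : M) :
    letI := (symPrebundle I F E h n).totalSpaceTopology
    letI := (symPrebundle I F E h n).toFiberBundle
    ContMDiffAt I (I.prod 𝓘(ℝ, EuclideanSpace ℝ (Fin (symRank F deg n)))) ∞
      (fun x => TotalSpace.mk' (EuclideanSpace ℝ (Fin (symRank F deg n))) x (s x)) x₀ ↔
    (fun x => symFiberIncl F h n x (s x)) ∈ symSmoothAt deg I F E x₀ := by
  let := (symPrebundle I F E h n).totalSpaceTopology
  let := (symPrebundle I F E h n).toFiberBundle
  rw [contMDiffAt_section]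
  change ContMDiffAt I _ ∞ (fun x => symCoord F E h n x₀ x (s x)) x₀ ↔ _
  refine ⟨fun hs => ?_, contMDiffAt_symCoord I F E h n (mem_symBaseSet deg ε F E n x₀)⟩
  refine symSmoothAt_congr ?_
    (symOfCoord_mem_symSmoothAt I F E h n (mem_symBaseSet deg ε F E n x₀) hs)
  filter_upwards [(isOpen_symBaseSet F E h n x₀).mem_nhds (mem_symBaseSet deg ε F E n x₀)] with x hx
  rw [symOfCoord_symCoord F E h n hx]

end SymPrebundle

/-! ### Bundle metrics and the isomorphism of a bundle with its dual -/

section BundleMetric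

variable {EM : Type*} [NormedAddCommGroup EM] [NormedSpace ℝ EM]
  {HM : Type*} [TopologicalSpace HM] {I : ModelWithCorners ℝ EM HM}
  {M : Type*} [TopologicalSpace M] [ChartedSpace HM M]
  {r : ℕ} {E : M → Type*} [TopologicalSpace (TotalSpace (EuclideanSpace ℝ (Fin r)) E)]
  [∀ x, AddCommGroup (E x)] [∀ x, Module ℝ (E x)] [∀ x, TopologicalSpace (E x)]
  [FiberBundle (EuclideanSpace ℝ (Fin r)) E] [VectorBundle ℝ (EuclideanSpace ℝ (Fin r)) E]

/-- The value of a smooth section of the dual bundle on a smooth section is smooth. -/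
theorem contMDiffAt_dual_apply {ξ : ∀ x, E x →L[ℝ] Trivial M ℝ x} {w : ∀ x, E x} {x₀ : M}
    (hξ : ContMDiffAt I (I.prod 𝓘(ℝ, EuclideanSpace ℝ (Fin r) →L[ℝ] ℝ)) ∞
      (fun x => TotalSpace.mk' (EuclideanSpace ℝ (Fin r) →L[ℝ] ℝ)
        (E := fun x => E x →L[ℝ] Trivial M ℝ x) x (ξ x)) x₀)
    (hw : ContMDiffAt I (I.prod 𝓘(ℝ, EuclideanSpace ℝ (Fin r))) ∞
      (fun x => TotalSpace.mk' (EuclideanSpace ℝ (Fin r)) x (w x)) x₀) :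
    ContMDiffAt I 𝓘(ℝ) ∞ (fun x => (ξ x (w x) : ℝ)) x₀ :=
  (contMDiffAt_section _).1 (hξ.clm_bundle_apply hw)

variable [ContMDiffVectorBundle ∞ (EuclideanSpace ℝ (Fin r)) E I]

theorem contMDiffAt_symm_trivialization {x₀ x₁ : M}
    (hx : x₁ ∈ (trivializationAt (EuclideanSpace ℝ (Fin r)) E x₀).baseSet)
    (v : EuclideanSpace ℝ (Fin r)) :
    ContMDiffAt I (I.prod 𝓘(ℝ, EuclideanSpace ℝ (Fin r))) ∞
      (fun x => TotalSpace.mk' (EuclideanSpace ℝ (Fin r)) x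
        ((trivializationAt (EuclideanSpace ℝ (Fin r)) E x₀).symm x v)) x₁ := by
  rw [Trivialization.contMDiffAt_section_iff _ hx]
  refine (contMDiffAt_const (c := v)).congr_of_eventuallyEq ?_
  filter_upwards [(trivializationAt (EuclideanSpace ℝ (Fin r)) E x₀).open_baseSet.mem_nhds hx]
    with x hx
  rw [Trivialization.apply_mk_symm _ hx]

/-- A section of the dual bundle is smooth if its values on smooth sections are. -/
theorem contMDiffAt_dual_of_apply {ξ : ∀ x, E x →L[ℝ] Trivial M ℝ x} {x₀ : M}
    (h : ∀ w : ∀ x, E x, ContMDiffAt I (I.prod 𝓘(ℝ, EuclideanSpace ℝ (Fin r))) ∞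
      (fun x => TotalSpace.mk' (EuclideanSpace ℝ (Fin r)) x (w x)) x₀ →
      ContMDiffAt I 𝓘(ℝ) ∞ (fun x => (ξ x (w x) : ℝ)) x₀) :
    ContMDiffAt I (I.prod 𝓘(ℝ, EuclideanSpace ℝ (Fin r) →L[ℝ] ℝ)) ∞
      (fun x => TotalSpace.mk' (EuclideanSpace ℝ (Fin r) →L[ℝ] ℝ)
        (E := fun x => E x →L[ℝ] Trivial M ℝ x) x (ξ x)) x₀ := by
  rw [contMDiffAt_hom_bundle]
  refine ⟨contMDiffAt_id, ?_⟩
  refine ContMDiffAt.of_apply_basis fun v => ?_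
  have hx₀ := mem_baseSet_trivializationAt (EuclideanSpace ℝ (Fin r)) E x₀
  refine (h _ (contMDiffAt_symm_trivialization hx₀ v)).congr_of_eventuallyEq ?_
  filter_upwards [(trivializationAt (EuclideanSpace ℝ (Fin r)) E x₀).open_baseSet.mem_nhds hx₀]
    with x hx
  simp [ContinuousLinearMap.inCoordinates, Trivialization.symmL_apply _ hx]

/-- A smooth vector bundle is isomorphic to its dual. -/
theorem exists_equiv_dual [FiniteDimensional ℝ EM] [T2Space M] [SigmaCompactSpace M]
    [IsManifold I ∞ M] :
    ∃ g : ∀ x, E x ≃ₗ[ℝ] (E x →L[ℝ] Trivial M ℝ x), ∀ (σ : ∀ x, E x) (x₀ : M),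
      ContMDiffAt I (I.prod 𝓘(ℝ, EuclideanSpace ℝ (Fin r))) ∞
        (fun x => TotalSpace.mk' (EuclideanSpace ℝ (Fin r)) x (σ x)) x₀ ↔
      ContMDiffAt I (I.prod 𝓘(ℝ, EuclideanSpace ℝ (Fin r) →L[ℝ] ℝ)) ∞
        (fun x => TotalSpace.mk' (EuclideanSpace ℝ (Fin r) →L[ℝ] ℝ)
          (E := fun x => E x →L[ℝ] Trivial M ℝ x) x (g x (σ x))) x₀ := by
  set e := trivializationAt (EuclideanSpace ℝ (Fin r)) E with he
  obtain ⟨ρ, hρ⟩ := SmoothPartitionOfUnity.exists_isSubordinate I (isClosed_univ (X := M))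
    (fun x => (e x).baseSet) (fun x => (e x).open_baseSet)
    (fun x _ => Set.mem_iUnion.2 ⟨x, mem_baseSet_trivializationAt _ _ x⟩)
  -- A bundle metric: the Euclidean inner products of the local trivializations, glued by the
  -- partition of unity.
  let B : ∀ x, E x →ₗ[ℝ] (E x →L[ℝ] Trivial M ℝ x) := fun x =>
    ∑ i ∈ ρ.finsupport x, ρ i x •
      { toFun := fun v => ((innerSL ℝ ((e i).continuousLinearMapAt ℝ x v)).comp
          ((e i).continuousLinearMapAt ℝ x) : E x →L[ℝ] ℝ)
        map_add' := fun v w => by ext; simp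
        map_smul' := fun c v => by ext; simp }
  have hB : ∀ x (v w : E x), (B x v w : ℝ) = ∑ i ∈ ρ.finsupport x, ρ i x *
      inner ℝ ((e i).continuousLinearMapAt ℝ x v) ((e i).continuousLinearMapAt ℝ x w) := by
    intro x v w
    simp only [B, LinearMap.sum_apply, sum_apply]
    rfl
  have hB' : ∀ x (v w : E x), (B x v w : ℝ) = ∑ᶠ i, ρ i x •
      inner ℝ ((e i).continuousLinearMapAt ℝ x v) ((e i).continuousLinearMapAt ℝ x w) := by
    intro x v w
    rw [hB]
    refine (finsum_eq_sum_of_support_subset _ fun i hi => ?_).symm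
    rw [SmoothPartitionOfUnity.coe_finsupport]
    exact left_ne_zero_of_smul hi
  have hsmooth : ∀ (σ w : ∀ x, E x) (x₀ : M),
      ContMDiffAt I (I.prod 𝓘(ℝ, EuclideanSpace ℝ (Fin r))) ∞
        (fun x => TotalSpace.mk' (EuclideanSpace ℝ (Fin r)) x (σ x)) x₀ →
      ContMDiffAt I (I.prod 𝓘(ℝ, EuclideanSpace ℝ (Fin r))) ∞
        (fun x => TotalSpace.mk' (EuclideanSpace ℝ (Fin r)) x (w x)) x₀ →
      ContMDiffAt I 𝓘(ℝ) ∞ (fun x => (B x (σ x) (w x) : ℝ)) x₀ := by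
    intro σ w x₀ hσ hw
    simp only [hB']
    refine ρ.contMDiffAt_finsum fun i hi => ?_
    have hx₀ : x₀ ∈ (e i).baseSet := hρ i hi
    have key : ∀ τ : ∀ x, E x, ContMDiffAt I (I.prod 𝓘(ℝ, EuclideanSpace ℝ (Fin r))) ∞
        (fun x => TotalSpace.mk' (EuclideanSpace ℝ (Fin r)) x (τ x)) x₀ →
        ContMDiffAt I 𝓘(ℝ, EuclideanSpace ℝ (Fin r)) ∞
          (fun x => (e i).continuousLinearMapAt ℝ x (τ x)) x₀ := by
      intro τ hτ
      rw [Trivialization.contMDiffAt_section_iff (e i) hx₀] at hτ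
      refine hτ.congr_of_eventuallyEq ?_
      filter_upwards [(e i).open_baseSet.mem_nhds hx₀] with x hx
      simp [Trivialization.linearMapAt_apply, hx]
    exact (contDiff_inner.contDiffAt.contMDiffAt).comp x₀ ((key σ hσ).prodMk_space (key w hw))
  -- Positive definiteness: in `B x v v` all terms are non-negative, and some `ρ i x` is positive,
  -- with the trivialization `e i` defined at `x`.
  have hpos : ∀ x (v : E x), B x v = 0 → v = 0 := by
    intro x v hv
    obtain ⟨i, hi⟩ := ρ.exists_pos_of_mem (Set.mem_univ x)
    have hx : x ∈ (e i).baseSet :=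
      hρ i (subset_tsupport _ (Function.mem_support.2 hi.ne'))
    have h0 : (B x v v : ℝ) = 0 := by rw [hv]; rfl
    rw [hB, Finset.sum_eq_zero_iff_of_nonneg
      fun j _ => mul_nonneg (ρ.nonneg j x) real_inner_self_nonneg] at h0
    have h1 := h0 i ((ρ.mem_finsupport x).2 hi.ne')
    rw [mul_eq_zero, or_iff_right hi.ne', inner_self_eq_zero] at h1
    rw [← (e i).symmL_continuousLinearMapAt (R := ℝ) hx v, h1, map_zero]
  -- Injectivity suffices, since in coordinates source and target have the same finite dimension.
  have hbij : ∀ x, Function.Bijective (B x) := by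
    intro x
    have hx : x ∈ (e x).baseSet := mem_baseSet_trivializationAt _ _ x
    let L : E x ≃L[ℝ] EuclideanSpace ℝ (Fin r) := (e x).continuousLinearEquivAt ℝ x hx
    let L' : (E x →L[ℝ] Trivial M ℝ x) ≃ₗ[ℝ] (EuclideanSpace ℝ (Fin r) →ₗ[ℝ] ℝ) :=
      { toFun := fun ξ => (ξ.comp (L.symm : EuclideanSpace ℝ (Fin r) →L[ℝ] E x)).toLinearMap
        map_add' := fun _ _ => rfl
        map_smul' := fun _ _ => rfl
        invFun := fun η => (LinearMap.toContinuousLinearMap η).comp (L : E x →L[ℝ] _)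
        left_inv := fun ξ => by ext v; simp
        right_inv := fun η => by ext v; simp }
    have hinj : Function.Injective (L'.toLinearMap ∘ₗ B x ∘ₗ L.symm.toLinearMap) := by
      have h1 : Function.Injective (B x) := (injective_iff_map_eq_zero (B x)).2 (hpos x)
      exact L'.injective.comp (h1.comp L.symm.injective)
    have hsurj := (LinearMap.injective_iff_surjective_of_finrank_eq_finrank
      (Subspace.dual_finrank_eq (K := ℝ) (V := EuclideanSpace ℝ (Fin r))).symm).1 hinj
    refine ⟨(injective_iff_map_eq_zero (B x)).2 (hpos x), fun ξ => ?_⟩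
    obtain ⟨v, hv⟩ := hsurj (L' ξ)
    exact ⟨L.symm v, L'.injective hv⟩
  refine ⟨fun x => LinearEquiv.ofBijective (B x) (hbij x), fun σ x₀ => ⟨fun hσ =>
    contMDiffAt_dual_of_apply fun w hw => hsmooth σ w x₀ hσ hw, fun hσ => ?_⟩⟩
  have hx₀ : x₀ ∈ (e x₀).baseSet := mem_baseSet_trivializationAt _ _ x₀
  let S : ∀ x, EuclideanSpace ℝ (Fin r) →L[ℝ] E x := fun x => (e x₀).symmL ℝ x
  -- The Gram matrix of the metric in the trivialization around `x₀`. A section has coordinates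
  -- `G⁻¹` applied to those of its image in the dual, so the converse follows from smoothness of
  -- inversion.
  let G : M → EuclideanSpace ℝ (Fin r) →L[ℝ] EuclideanSpace ℝ (Fin r) →L[ℝ] ℝ := fun x =>
    LinearMap.toContinuousLinearMap
      { toFun := fun a => ((B x (S x a)).comp (S x) : EuclideanSpace ℝ (Fin r) →L[ℝ] ℝ)
        map_add' := fun a b => by ext; simp
        map_smul' := fun c a => by ext; simp }
  have hS : ∀ a, ContMDiffAt I (I.prod 𝓘(ℝ, EuclideanSpace ℝ (Fin r))) ∞
      (fun x => TotalSpace.mk' (EuclideanSpace ℝ (Fin r)) x (S x a)) x₀ := by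
    intro a
    refine (contMDiffAt_symm_trivialization hx₀ a).congr_of_eventuallyEq ?_
    filter_upwards [(e x₀).open_baseSet.mem_nhds hx₀] with x hx
    simp only [S]
    rw [Trivialization.symmL_apply _ hx]
  have hG : ContMDiffAt I 𝓘(ℝ, EuclideanSpace ℝ (Fin r) →L[ℝ] EuclideanSpace ℝ (Fin r) →L[ℝ] ℝ) ∞
      G x₀ := ContMDiffAt.of_apply_basis fun a => ContMDiffAt.of_apply_basis fun b =>
        hsmooth _ _ x₀ (hS a) (hS b)
  have hGbij : ∀ x ∈ (e x₀).baseSet, Function.Injective (G x) := by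
    intro x hx
    refine (injective_iff_map_eq_zero (G x)).2 fun a ha => ?_
    have h1 : B x (S x a) = 0 := by
      ext w
      have := DFunLike.congr_fun ha ((e x₀).continuousLinearMapAt ℝ x w)
      simp only [G, S, LinearMap.coe_toContinuousLinearMap', LinearMap.coe_mk, AddHom.coe_mk,
        ContinuousLinearMap.comp_apply] at this
      erw [(e x₀).symmL_continuousLinearMapAt hx w] at this
      exact this
    rw [← (e x₀).continuousLinearMapAt_symmL (R := ℝ) hx a]
    erw [hpos x _ h1]
    rw [map_zero]
  have hGinv : ∀ x ∈ (e x₀).baseSet, ∃ g : EuclideanSpace ℝ (Fin r) ≃L[ℝ]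
      (EuclideanSpace ℝ (Fin r) →L[ℝ] ℝ), (g : _ →L[ℝ] _) = G x := by
    intro x hx
    have hfr : Module.finrank ℝ (EuclideanSpace ℝ (Fin r)) =
        Module.finrank ℝ (EuclideanSpace ℝ (Fin r) →L[ℝ] ℝ) := by
      rw [← (LinearMap.toContinuousLinearMap (𝕜 := ℝ) (E := EuclideanSpace ℝ (Fin r))
        (F' := ℝ)).finrank_eq]
      exact (Subspace.dual_finrank_eq (K := ℝ) (V := EuclideanSpace ℝ (Fin r))).symm
    exact ⟨(LinearEquiv.ofInjectiveOfFinrankEq (G x : _ →ₗ[ℝ] _) (hGbij x hx)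
      hfr).toContinuousLinearEquiv, rfl⟩
  have hinv : ContMDiffAt I 𝓘(ℝ, (EuclideanSpace ℝ (Fin r) →L[ℝ] ℝ) →L[ℝ] EuclideanSpace ℝ (Fin r))
      ∞ (fun x => (G x).inverse) x₀ := by
    obtain ⟨g, hg⟩ := hGinv x₀ hx₀
    have := contDiffAt_map_inverse (𝕜 := ℝ) (n := ∞) g
    rw [hg] at this
    exact this.contMDiffAt.comp x₀ hG
  have hγ : ContMDiffAt I 𝓘(ℝ, EuclideanSpace ℝ (Fin r) →L[ℝ] ℝ) ∞
      (fun x => ((B x (σ x)).comp (S x) : EuclideanSpace ℝ (Fin r) →L[ℝ] ℝ)) x₀ :=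
    ContMDiffAt.of_apply_basis fun a => contMDiffAt_dual_apply (w := fun x => S x a) hσ (hS a)
  rw [Trivialization.contMDiffAt_section_iff (e x₀) hx₀]
  refine (hinv.clm_apply hγ).congr_of_eventuallyEq ?_
  filter_upwards [(e x₀).open_baseSet.mem_nhds hx₀] with x hx
  obtain ⟨g, hg⟩ := hGinv x hx
  have h1 : ((B x (σ x)).comp (S x) : EuclideanSpace ℝ (Fin r) →L[ℝ] ℝ) =
      g ((e x₀).continuousLinearMapAt ℝ x (σ x)) := by
    rw [← ContinuousLinearEquiv.coe_coe, hg]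
    simp only [G, S, LinearMap.coe_toContinuousLinearMap', LinearMap.coe_mk, AddHom.coe_mk]
    erw [(e x₀).symmL_continuousLinearMapAt hx]
  rw [h1, ← hg, ContinuousLinearMap.inverse_equiv]
  simp [Trivialization.linearMapAt_apply, hx]

end BundleMetric

/-! ### Smooth sections under passage to opposite degrees -/

section MapNegSmooth

variable {ι : Type*} [DecidableEq ι] {deg deg' : ι → ℤ}
  {EM : Type*} [NormedAddCommGroup EM] [NormedSpace ℝ EM]
  {HM : Type*} [TopologicalSpace HM] {I : ModelWithCorners ℝ EM HM}
  {M : Type*} [TopologicalSpace M] [ChartedSpace HM M]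
  {F : ι → Type*} [∀ i, NormedAddCommGroup (F i)] [∀ i, NormedSpace ℝ (F i)]
  {E : ι → M → Type*} [∀ i, TopologicalSpace (TotalSpace (F i) (E i))]
  [∀ i x, AddCommGroup (E i x)] [∀ i x, Module ℝ (E i x)] [∀ i x, TopologicalSpace (E i x)]
  [∀ i, FiberBundle (F i) (E i)] [∀ i, VectorBundle ℝ (F i) (E i)]
  {F' : ι → Type*} [∀ i, NormedAddCommGroup (F' i)] [∀ i, NormedSpace ℝ (F' i)]
  {E' : ι → M → Type*} [∀ i, TopologicalSpace (TotalSpace (F' i) (E' i))]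
  [∀ i x, AddCommGroup (E' i x)] [∀ i x, Module ℝ (E' i x)] [∀ i x, TopologicalSpace (E' i x)]
  [∀ i, FiberBundle (F' i) (E' i)] [∀ i, VectorBundle ℝ (F' i) (E' i)]

/-- A family of fibrewise algebra morphisms that sends the elementary smooth sections to smooth
sections preserves smoothness. -/
theorem mem_symSmoothAt_of_generators
    (Φ : ∀ x, GSym deg (fun i => E i x) →ₐ[ℝ] GSym deg' (fun i => E' i x)) {x₀ : M}
    (hΦ : ∀ i (σ : ∀ x, E i x), ContMDiffAt I (I.prod 𝓘(ℝ, F i)) ∞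
      (fun x => TotalSpace.mk' (F i) x (σ x)) x₀ →
      (fun x => Φ x (GSym.gen deg i (σ x))) ∈ symSmoothAt deg' I F' E' x₀)
    {s : ∀ x, GSym deg (fun i => E i x)} (hs : s ∈ symSmoothAt deg I F E x₀) :
    (fun x => Φ x (s x)) ∈ symSmoothAt deg' I F' E' x₀ := by
  obtain ⟨t, ht, hst⟩ := hs
  refine symSmoothAt_congr (s' := fun x => Φ x (t x))
    (by filter_upwards [hst] with x hx; rw [hx]) ?_
  clear hst
  induction ht using Algebra.adjoin_induction with
  | mem t ht =>
    obtain ⟨f, hf, rfl⟩ | ⟨i, σ, hσ, rfl⟩ := ht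
    · simp only [AlgHom.commutes]
      exact algebraMap_mem_symSmoothAt hf
    · exact hΦ i σ hσ
  | algebraMap r =>
    simp only [Pi.algebraMap_apply, AlgHom.commutes]
    exact Subalgebra.algebraMap_mem (symSmoothAt deg' I F' E' x₀) r
  | add g g' _ _ hg hg' => simp only [Pi.add_apply, map_add]; exact add_mem hg hg'
  | mul g g' _ _ hg hg' => simp only [Pi.mul_apply, map_mul]; exact mul_mem hg hg'

/-- Fibrewise isomorphisms under which the smooth sections correspond induce isomorphisms of
graded-symmetric algebra bundles (for opposite degrees) under which the smooth sections
correspond. -/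
theorem pieceNegEquiv_mem_symSmoothAt_iff (hdeg : ∀ i, deg' i = -deg i)
    (f : ∀ i x, E i x ≃ₗ[ℝ] E' i x) {x₀ : M}
    (hf : ∀ i (σ : ∀ x, E i x), ContMDiffAt I (I.prod 𝓘(ℝ, F i)) ∞
      (fun x => TotalSpace.mk' (F i) x (σ x)) x₀ ↔ ContMDiffAt I (I.prod 𝓘(ℝ, F' i)) ∞
      (fun x => TotalSpace.mk' (F' i) x (f i x (σ x))) x₀) {n : ℤ}
    (s : ∀ x, GSym.piece deg (fun i => E i x) n) :
    (fun x => (GSym.pieceNegEquiv hdeg (fun i => f i x) n (s x) :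
      GSym deg' (fun i => E' i x))) ∈ symSmoothAt deg' I F' E' x₀ ↔
    (fun x => (s x : GSym deg (fun i => E i x))) ∈ symSmoothAt deg I F E x₀ := by
  constructor
  · intro h
    have h1 := mem_symSmoothAt_of_generators (deg' := deg) (F' := F) (E' := E)
      (fun x => GSym.mapNeg deg' (fun i => by rw [hdeg, neg_neg])
        fun i => ((f i x).symm : E' i x →ₗ[ℝ] E i x))
      (fun i σ hσ => by
        simp only [GSym.mapNeg_gen]
        refine gen_mem_symSmoothAt ((hf i fun x => (f i x).symm (σ x)).2 ?_)
        simpa using hσ) h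
    refine symSmoothAt_congr (Filter.Eventually.of_forall fun x => ?_) h1
    exact congrArg Subtype.val
      ((GSym.pieceNegEquiv hdeg (fun i => f i x) n).symm_apply_apply (s x)).symm
  · exact mem_symSmoothAt_of_generators
      (fun x => GSym.mapNeg deg hdeg fun i => (f i x : E i x →ₗ[ℝ] E' i x))
      (fun i σ hσ => by
        simp only [GSym.mapNeg_gen]
        exact gen_mem_symSmoothAt ((hf i σ).1 hσ))

end MapNegSmooth

/-! ### The bundle `S^{≥ 1}(V)` and its dual -/

namespace NegGradedVectBundle

instance (V : NegGradedVectBundle.{u}) : SigmaCompactSpace V.base :=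
  have : LocallyCompactSpace V.base :=
    ChartedSpace.locallyCompactSpace (EuclideanSpace ℝ (Fin V.dim)) V.base
  inferInstance

theorem isLocallyFiniteDeg : IsLocallyFiniteDeg (fun k : NegInt => k.1) (-1) where
  pos k := by have := k.2; omega
  finite n := by
    refine (((Set.finite_Icc (-n) 0)).preimage Subtype.val_injective.injOn).subset fun k hk => ?_
    have := k.2
    simp only [Set.mem_ofPred_eq] at hk
    exact ⟨by omega, by omega⟩

theorem dualDeg_eq_neg (k : NegInt) : dualDeg k = -k.1 := rfl

theorem isLocallyFiniteDeg_dualDeg : IsLocallyFiniteDeg dualDeg 1 where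
  pos k := by have := isLocallyFiniteDeg.pos k; rw [dualDeg_eq_neg]; omega
  finite n := by
    refine (isLocallyFiniteDeg.finite n).subset fun k hk => ?_
    simp only [Set.mem_ofPred_eq, dualDeg_eq_neg] at hk ⊢
    omega

/-- A negatively graded vector bundle over the base of `V`. -/
structure BundlesOver (V : NegGradedVectBundle.{u}) : Type (u + 1) where
  rank : NegInt → ℕ
  fiber : NegInt → V.base → Type u
  [addCommGroupFiber : ∀ k x, AddCommGroup (fiber k x)]
  [moduleFiber : ∀ k x, Module ℝ (fiber k x)]
  [topFiber : ∀ k x, TopologicalSpace (fiber k x)]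
  [topTotal : ∀ k, TopologicalSpace (TotalSpace (EuclideanSpace ℝ (Fin (rank k))) (fiber k))]
  [fiberBundle : ∀ k, FiberBundle (EuclideanSpace ℝ (Fin (rank k))) (fiber k)]
  [vectorBundle : ∀ k, VectorBundle ℝ (EuclideanSpace ℝ (Fin (rank k))) (fiber k)]
  [smoothBundle : ∀ k,
    ContMDiffVectorBundle ∞ (EuclideanSpace ℝ (Fin (rank k))) (fiber k) (𝓡 V.dim)]

attribute [instance] BundlesOver.addCommGroupFiber BundlesOver.moduleFiber BundlesOver.topFiber
  BundlesOver.topTotal BundlesOver.fiberBundle BundlesOver.vectorBundle BundlesOver.smoothBundle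

variable {V : NegGradedVectBundle.{u}}

/-- The graded vector bundle with the same base as `V` given by `D`. -/
abbrev BundlesOver.total (D : BundlesOver V) : NegGradedVectBundle.{u} where
  dim := V.dim
  base := V.base
  rank := D.rank
  fiber := D.fiber

/-- The graded vector bundle `D` over the base of `V` is isomorphic to `S^{≥ 1}(V)`. -/
def BundlesOver.IsSymmetric (D : BundlesOver V) : Prop :=
  ∃ θ : ∀ (k : NegInt) (x : V.base),
      GSym.piece (fun j : NegInt => j.1) (fun j => V.fiber j x) k.1 ≃ₗ[ℝ] D.fiber k x,
    ∀ (k : NegInt)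
      (s : ∀ x, GSym.piece (fun j : NegInt => j.1) (fun j => V.fiber j x) k.1) (x₀ : V.base),
      (fun x => (s x : GSym (fun j : NegInt => j.1) (fun j => V.fiber j x))) ∈
          symSmoothAt (fun j : NegInt => j.1) (𝓡 V.dim) V.modelFiber V.fiber x₀ ↔
        ContMDiffAt (𝓡 V.dim) ((𝓡 V.dim).prod 𝓘(ℝ, EuclideanSpace ℝ (Fin (D.rank k)))) ∞
          (fun x => TotalSpace.mk' (EuclideanSpace ℝ (Fin (D.rank k))) x (θ k x (s x))) x₀

variable (V) in
-- The prebundles of the homogeneous parts supply `D`, and `contMDiffAt_symSection_iff` matches the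
-- two notions of smooth section.
theorem exists_isSymmetric : ∃ D : BundlesOver V, D.IsSymmetric := by
  let a := fun k : NegInt => symPrebundle (𝓡 V.dim) V.modelFiber V.fiber isLocallyFiniteDeg k.1
  let D : BundlesOver V :=
    { rank := fun k => symRank V.modelFiber (fun j : NegInt => j.1) k.1
      fiber := fun k => SymFiber V.modelFiber V.fiber isLocallyFiniteDeg k.1
      topTotal := fun k => (a k).totalSpaceTopology
      fiberBundle := fun k => (a k).toFiberBundle
      vectorBundle := fun k => (a k).toVectorBundle
      smoothBundle := fun k => (a k).contMDiffVectorBundle (𝓡 V.dim) }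
  refine ⟨D, fun k x => symFiberEquiv V.modelFiber V.fiber isLocallyFiniteDeg k.1 x,
    fun k s x₀ => ?_⟩
  exact (contMDiffAt_symSection_iff (𝓡 V.dim) V.modelFiber V.fiber isLocallyFiniteDeg k.1
    (fun x => symFiberEquiv V.modelFiber V.fiber isLocallyFiniteDeg k.1 x (s x)) x₀).symm

theorem BundlesOver.IsSymmetric.isReducedSymmetricBundle {D : BundlesOver V} (h : D.IsSymmetric) :
    IsReducedSymmetricBundle V D.total := by
  obtain ⟨θ, hθ⟩ := h
  exact ⟨Diffeomorph.refl _ _ _, θ, hθ⟩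

/-- The dual of `D_k` is identified with `D_k` by a metric on `D_k`, then with the degree `k` part
of `S(V)`, then with the degree `-k` part of `S(V^*)` by metrics on the `V_j`. The choice is not
canonical, but only the matching of smooth sections is needed. -/
theorem BundlesOver.IsSymmetric.exists_dual_equiv {D : BundlesOver V} (h : D.IsSymmetric) :
    ∃ ψ : ∀ (k : NegInt) (x : V.base), D.total.dualFiber k x ≃ₗ[ℝ]
        GSym.piece dualDeg (fun j => V.dualFiber j x) (dualDeg k),
      ∀ (k : NegInt) (σ : ∀ x, D.total.dualFiber k x) (x₀ : V.base),
        ContMDiffAt (𝓡 V.dim) ((𝓡 V.dim).prod 𝓘(ℝ, D.total.modelFiber k →L[ℝ] ℝ)) ∞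
          (fun x => TotalSpace.mk' (D.total.modelFiber k →L[ℝ] ℝ) (E := D.total.dualFiber k)
            x (σ x)) x₀ ↔
        (fun x => (ψ k x (σ x) : GSym dualDeg (fun j => V.dualFiber j x))) ∈
          symSmoothAt dualDeg (𝓡 V.dim) (fun k => V.modelFiber k →L[ℝ] ℝ) V.dualFiber x₀ := by
  obtain ⟨θ, hθ⟩ := h
  choose g hg using fun k => exists_equiv_dual (I := 𝓡 V.dim) (r := V.rank k) (E := V.fiber k)
  choose gD hgD using fun k => exists_equiv_dual (I := 𝓡 V.dim) (r := D.rank k) (E := D.fiber k)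
  refine ⟨fun k x => (gD k x).symm ≪≫ₗ (θ k x).symm ≪≫ₗ
    GSym.pieceNegEquiv dualDeg_eq_neg (fun j => g j x) k.1, fun k σ x₀ => ?_⟩
  have h1 := hgD k (fun x => (gD k x).symm (σ x)) x₀
  have h2 := hθ k (fun x => (θ k x).symm ((gD k x).symm (σ x))) x₀
  have h3 := pieceNegEquiv_mem_symSmoothAt_iff dualDeg_eq_neg (fun j x => g j x) (x₀ := x₀)
    (fun i σ => hg i σ x₀) (fun x => (θ k x).symm ((gD k x).symm (σ x)))
  simp only [LinearEquiv.apply_symm_apply] at h1 h2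
  exact h1.symm.trans (h2.symm.trans h3.symm)

end NegGradedVectBundle

/-! ### Smooth functions determine points and smooth maps -/

section SmoothFunctions

variable {EM : Type*} [NormedAddCommGroup EM] [NormedSpace ℝ EM] [FiniteDimensional ℝ EM]
  {HM : Type*} [TopologicalSpace HM] {I : ModelWithCorners ℝ EM HM}
  {M : Type*} [TopologicalSpace M] [ChartedSpace HM M] [IsManifold I ∞ M] [T2Space M]

theorem exists_bump {x₀ : M} {s : Set M} (hs : s ∈ 𝓝 x₀) :
    ∃ f : C^∞⟮I, M; 𝓘(ℝ), ℝ⟯, (∀ᶠ x in 𝓝 x₀, f x = 1) ∧ tsupport f ⊆ s := by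
  obtain ⟨f, -, hf⟩ := (SmoothBumpFunction.nhds_basis_tsupport (I := I) x₀).mem_iff.1 hs
  exact ⟨⟨f, f.contMDiff⟩, f.eventuallyEq_one, hf⟩

/-- Multiplication by a bump function supported in `s` extends the local function by zero. -/
theorem exists_contMDiffMap_eventuallyEq {x₀ : M} {s : Set M} (hs : s ∈ 𝓝 x₀) {c : M → ℝ}
    (hc : ∀ x ∈ s, ContMDiffAt I 𝓘(ℝ) ∞ c x) :
    ∃ g : C^∞⟮I, M; 𝓘(ℝ), ℝ⟯, ∀ᶠ x in 𝓝 x₀, g x = c x := by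
  obtain ⟨f, hf1, hf⟩ := exists_bump (I := I) hs
  refine ⟨⟨fun x => f x * c x, contMDiff_of_tsupport fun x hx => ?_⟩, ?_⟩
  · exact f.contMDiff.contMDiffAt.mul (hc x (hf (tsupport_mul_subset_left hx)))
  · filter_upwards [hf1] with x hx
    simp [hx]

variable (I) in
/-- The evaluation of smooth functions at a point. -/
def evalAlgHom (p : M) : C^∞⟮I, M; 𝓘(ℝ), ℝ⟯ →ₐ[ℝ] ℝ :=
  (Pi.evalAlgHom ℝ _ p).comp ContMDiffMap.coeFnAlgHom

theorem evalAlgHom_apply (p : M) (f : C^∞⟮I, M; 𝓘(ℝ), ℝ⟯) : evalAlgHom I p f = f p := rfl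

variable [SigmaCompactSpace M]

/-- A character of the algebra of smooth functions on a manifold is the evaluation at a point. -/
theorem exists_eq_eval_of_character (χ : C^∞⟮I, M; 𝓘(ℝ), ℝ⟯ →ₐ[ℝ] ℝ) :
    ∃ p, ∀ f, χ f = f p := by
  -- A nowhere vanishing function is invertible and cannot lie in the kernel of a character.
  have hzero : ∀ f, χ f = 0 → ∃ p, f p = 0 := by
    intro f hf
    by_contra! hne
    have hinv : ContMDiff I 𝓘(ℝ) ∞ fun x => (f x)⁻¹ := fun x => f.contMDiff.contMDiffAt.inv₀ (hne x)
    let f' : C^∞⟮I, M; 𝓘(ℝ), ℝ⟯ := ⟨_, hinv⟩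
    have h1 : f * f' = 1 := by
      ext x
      exact mul_inv_cancel₀ (hne x)
    have h2 := congrArg χ h1
    rw [map_mul, hf, zero_mul, map_one] at h2
    exact zero_ne_one h2
  have : LocallyCompactSpace HM := I.locallyCompactSpace
  have : LocallyCompactSpace M := ChartedSpace.locallyCompactSpace HM M
  let K := CompactExhaustion.choice M
  -- `h` dominates the index of a compact exhaustion, so its level sets are compact. The constant
  -- `K.find x + 1` works near `x` because `x` is interior to the next compact set.
  obtain ⟨h, hh⟩ := exists_contMDiffMap_forall_mem_convex_of_local_const I (n := ⊤)
    (t := fun x => Set.Ici (K.find x : ℝ)) (fun x => convex_Ici _) (fun x => by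
      refine ⟨(K.find x + 1 : ℕ), ?_⟩
      filter_upwards [mem_interior_iff_mem_nhds.1 (K.subset_interior_succ _ (K.mem_find x))]
        with y hy
      exact Set.mem_Ici.2 (Nat.cast_le.2 (K.mem_iff_find_le.1 hy)))
  by_contra! hne
  have hne' : ∀ p, ∃ f, χ f = 0 ∧ f p ≠ 0 := by
    intro p
    obtain ⟨f, hf⟩ := hne p
    refine ⟨f - algebraMap ℝ _ (χ f), by rw [map_sub, AlgHom.commutes]; exact sub_self _, ?_⟩
    exact sub_ne_zero.2 (Ne.symm hf)
  choose g hg0 hgp using hne'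
  have hcomp : IsCompact {p | h p = χ h} := by
    obtain ⟨N, hN⟩ := exists_nat_ge (χ h)
    refine (K.isCompact N).of_isClosed_subset
      (isClosed_eq h.contMDiff.continuous continuous_const) fun p hp => ?_
    rw [K.mem_iff_find_le, ← Nat.cast_le (α := ℝ)]
    exact (hh p).trans (le_trans (le_of_eq hp) hN)
  obtain ⟨t, ht⟩ := hcomp.elim_finite_subcover (fun p => {q | g p q ≠ 0})
    (fun p => isOpen_ne_fun (g p).contMDiff.continuous continuous_const)
    (fun p _ => Set.mem_iUnion.2 ⟨p, hgp p⟩)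
  -- A sum of squares of kernel elements. A zero of it would lie on the level set `h = χ h` and be a
  -- common zero of the `g p` with `p ∈ t`, although these have no common zero there.
  obtain ⟨q, hq⟩ := hzero ((h - algebraMap ℝ _ (χ h)) ^ 2 + ∑ p ∈ t, g p ^ 2) (by
    simp [map_sub, AlgHom.commutes, hg0])
  have hq' : (h q - χ h) ^ 2 + ∑ p ∈ t, g p q ^ 2 = 0 := by
    rw [← evalAlgHom_apply] at hq
    simp only [map_add, map_pow, map_sub, map_sum, AlgHom.commutes] at hq
    exact hq
  have hs := Finset.sum_nonneg fun p (_ : p ∈ t) => sq_nonneg (g p q)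
  have h1 : h q = χ h := by nlinarith [sq_nonneg (h q - χ h)]
  obtain ⟨p, hp, hpq⟩ := Set.mem_iUnion₂.1 (ht h1)
  have h2 : ∑ p ∈ t, g p q ^ 2 = 0 := by nlinarith [sq_nonneg (h q - χ h)]
  exact hpq (pow_eq_zero_iff two_ne_zero |>.1
    ((Finset.sum_eq_zero_iff_of_nonneg fun p _ => sq_nonneg (g p q)).1 h2 p hp))

variable {EN : Type*} [NormedAddCommGroup EN] [NormedSpace ℝ EN]
  {HN : Type*} [TopologicalSpace HN] {J : ModelWithCorners ℝ EN HN}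
  {N : Type*} [TopologicalSpace N] [ChartedSpace HN N]

/-- A map to a manifold is smooth if its compositions with all smooth functions are smooth. -/
theorem contMDiff_of_comp_contMDiffMap {φ : N → M}
    (hφ : ∀ g : C^∞⟮I, M; 𝓘(ℝ), ℝ⟯, ContMDiff J 𝓘(ℝ) ∞ (g ∘ φ)) : ContMDiff J I ∞ φ := by
  intro x
  -- Continuity is not assumed: the pullback of a bump function supported in `s` is continuous and
  -- non-zero at `x`, so nearby points are mapped into `s`.
  have hcont : ContinuousAt φ x := by
    intro s hs
    obtain ⟨f, hf1, hf⟩ := exists_bump (I := I) hs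
    have h1 : f (φ x) ≠ 0 := by rw [hf1.self_of_nhds]; exact one_ne_zero
    change ∀ᶠ y in 𝓝 x, φ y ∈ s
    filter_upwards [(hφ f).continuous.continuousAt.eventually_ne h1] with y hy
    exact hf (subset_tsupport _ hy)
  refine contMDiffAt_iff_target.2 ⟨hcont, ?_⟩
  let b := Module.finBasis ℝ EM
  have key : ∀ j, ContMDiffAt J 𝓘(ℝ) ∞
      (fun y => (b.coord j).toContinuousLinearMap (extChartAt I (φ x) (φ y))) x := by
    intro j
    -- The hypothesis concerns global functions only, so the chart coordinate is replaced by a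
    -- global function with the same germ at `φ x`.
    obtain ⟨g, hg⟩ := exists_contMDiffMap_eventuallyEq (I := I)
      ((chartAt HM (φ x)).open_source.mem_nhds (mem_chart_source HM (φ x)))
      (c := fun z => (b.coord j).toContinuousLinearMap (extChartAt I (φ x) z)) (fun z hz =>
        (ContinuousLinearMap.contMDiff _).contMDiffAt.comp z (contMDiffAt_extChartAt' hz))
    exact (hφ g x).congr_of_eventuallyEq (by
      filter_upwards [hcont.eventually hg] with y hy using hy.symm)
  have hsum : extChartAt I (φ x) ∘ φ = fun y => ∑ j,
      (b.coord j).toContinuousLinearMap (extChartAt I (φ x) (φ y)) • b j := by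
    funext y
    conv_lhs => rw [← b.sum_repr ((extChartAt I (φ x) ∘ φ) y)]
    simp
  rw [hsum]
  exact ContMDiffAt.sum fun j _ => (key j).smul contMDiffAt_const

end SmoothFunctions

/-! ### Global extension of germs of sections; the augmentation -/

section GlobalSections

variable {EM : Type*} [NormedAddCommGroup EM] [NormedSpace ℝ EM] [FiniteDimensional ℝ EM]
  {HM : Type*} [TopologicalSpace HM] {I : ModelWithCorners ℝ EM HM}
  {M : Type*} [TopologicalSpace M] [ChartedSpace HM M] [IsManifold I ∞ M] [T2Space M]
  {F : Type*} [NormedAddCommGroup F] [NormedSpace ℝ F]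
  {E : M → Type*} [TopologicalSpace (TotalSpace F E)]
  [∀ x, AddCommGroup (E x)] [∀ x, Module ℝ (E x)] [∀ x, TopologicalSpace (E x)]
  [FiberBundle F E] [VectorBundle ℝ F E]

/-- Algebra morphisms act on global sections only, so local frames have to be cut off by bump
functions. -/
theorem exists_section_eventuallyEq {x₀ : M} {s : Set M} (hs : s ∈ 𝓝 x₀) {σ : ∀ x, E x}
    (hσ : ∀ x ∈ s, ContMDiffAt I (I.prod 𝓘(ℝ, F)) ∞ (fun x => TotalSpace.mk' F x (σ x)) x) :
    ∃ τ : ∀ x, E x, ContMDiff I (I.prod 𝓘(ℝ, F)) ∞ (fun x => TotalSpace.mk' F x (τ x)) ∧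
      ∀ᶠ x in 𝓝 x₀, τ x = σ x := by
  obtain ⟨u, hus, hu, hxu⟩ := mem_nhds_iff.1 hs
  obtain ⟨f, hf1, hf⟩ := exists_bump (I := I) (hu.mem_nhds hxu)
  refine ⟨fun x => f x • σ x, ContMDiffOn.smul_section_of_tsupport
    (f.contMDiff.contMDiffOn) hu hf fun x hx => (hσ x (hus hx)).contMDiffWithinAt, ?_⟩
  filter_upwards [hf1] with x hx
  simp [hx]

end GlobalSections

theorem contMDiffAt_augmentation {ι : Type*} [DecidableEq ι] {deg : ι → ℤ}
    {EM : Type*} [NormedAddCommGroup EM] [NormedSpace ℝ EM]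
    {HM : Type*} [TopologicalSpace HM] {I : ModelWithCorners ℝ EM HM}
    {M : Type*} [TopologicalSpace M] [ChartedSpace HM M]
    {F : ι → Type*} [∀ i, NormedAddCommGroup (F i)] [∀ i, NormedSpace ℝ (F i)]
    {E : ι → M → Type*} [∀ i, TopologicalSpace (TotalSpace (F i) (E i))]
    [∀ i x, AddCommGroup (E i x)] [∀ i x, Module ℝ (E i x)] [∀ i x, TopologicalSpace (E i x)]
    [∀ i, FiberBundle (F i) (E i)] {x₀ : M} {s : ∀ x, GSym deg (fun i => E i x)}
    (hs : s ∈ symSmoothAt deg I F E x₀) :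
    ContMDiffAt I 𝓘(ℝ) ∞ (fun x => GSym.augmentation deg _ (s x)) x₀ := by
  obtain ⟨t, ht, hst⟩ := hs
  refine ContMDiffAt.congr_of_eventuallyEq (f := fun x => GSym.augmentation deg _ (t x)) ?_
    (by filter_upwards [hst] with x hx; rw [hx])
  clear hst
  induction ht using Algebra.adjoin_induction with
  | mem t ht =>
    obtain ⟨f, hf, rfl⟩ | ⟨i, σ, hσ, rfl⟩ := ht
    · simpa using hf
    · simpa using contMDiffAt_const
  | algebraMap r => simpa using contMDiffAt_const
  | add g g' _ _ hg hg' => simp only [Pi.add_apply, map_add]; exact hg.add hg'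
  | mul g g' _ _ hg hg' => simp only [Pi.mul_apply, map_mul]; exact hg.mul hg'

/-! ### Local generation of the function algebra -/

namespace NegGradedVectBundle

variable {V : NegGradedVectBundle.{u}}

/-- The smooth functions on the base. -/
abbrev SmoothFun (V : NegGradedVectBundle.{u}) : Type u := C^∞⟮𝓡 V.dim, V.base; 𝓘(ℝ), ℝ⟯

/-- The smooth sections of the dual bundle in degree `k`. -/
def IsDualSection {k : NegInt} (σ : ∀ x, V.dualFiber k x) : Prop :=
  ContMDiff (𝓡 V.dim) ((𝓡 V.dim).prod 𝓘(ℝ, V.modelFiber k →L[ℝ] ℝ)) ∞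
    (fun x => TotalSpace.mk' (V.modelFiber k →L[ℝ] ℝ) (E := V.dualFiber k) x (σ x))

theorem mem_functionAlgebra {n : ℤ} {s : ∀ x, GSym dualDeg (fun k => V.dualFiber k x)}
    (hs : s ∈ symSections dualDeg (𝓡 V.dim) (fun k => V.modelFiber k →L[ℝ] ℝ) V.dualFiber n) :
    s ∈ V.functionAlgebra :=
  Submodule.mem_iSup_of_mem (p := symSections dualDeg (𝓡 V.dim)
    (fun k => V.modelFiber k →L[ℝ] ℝ) V.dualFiber) n hs

theorem algebraMap_mem_symSections (f : V.SmoothFun) :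
    (fun x => algebraMap ℝ _ (f x)) ∈
      symSections dualDeg (𝓡 V.dim) (fun k => V.modelFiber k →L[ℝ] ℝ) V.dualFiber 0 :=
  ⟨fun x => by
    change algebraMap ℝ (GSym dualDeg (fun k => V.dualFiber k x)) (f x) ∈ _
    rw [Algebra.algebraMap_eq_smul_one]
    exact Submodule.smul_mem _ _ SetLike.GradedOne.one_mem,
    fun x => algebraMap_mem_symSmoothAt (f.contMDiff x)⟩

theorem gen_mem_symSections {k : NegInt} {σ : ∀ x, V.dualFiber k x} (hσ : IsDualSection σ) :
    (fun x => GSym.gen dualDeg (W := fun k => V.dualFiber k x) k (σ x)) ∈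
      symSections dualDeg (𝓡 V.dim) (fun k => V.modelFiber k →L[ℝ] ℝ) V.dualFiber (dualDeg k) :=
  ⟨fun x => GSym.gen_mem dualDeg (W := fun k => V.dualFiber k x) k (σ x), fun x => gen_mem_symSmoothAt (hσ x)⟩

/-- The smooth functions as elements of degree `0` of the function algebra. -/
def ofFun : V.SmoothFun →ₐ[ℝ] V.functionAlgebra where
  toFun f := ⟨_, mem_functionAlgebra (algebraMap_mem_symSections f)⟩
  map_one' := Subtype.ext (funext fun _ => map_one (algebraMap ℝ _))
  map_mul' f g := Subtype.ext (funext fun x => map_mul (algebraMap ℝ _) (f x) (g x))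
  map_zero' := Subtype.ext (funext fun _ => map_zero (algebraMap ℝ _))
  map_add' f g := Subtype.ext (funext fun x => map_add (algebraMap ℝ _) (f x) (g x))
  commutes' _ := rfl

theorem ofFun_apply (f : V.SmoothFun) (x : V.base) : (ofFun f).1 x = algebraMap ℝ _ (f x) := rfl

theorem ofFun_mem (f : V.SmoothFun) : ofFun f ∈ V.functionGrading 0 :=
  algebraMap_mem_symSections f

/-- The smooth sections of the dual bundles as elements of the function algebra. -/
def ofSection {k : NegInt} (σ : ∀ x, V.dualFiber k x) (hσ : IsDualSection σ) : V.functionAlgebra :=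
  ⟨_, mem_functionAlgebra (gen_mem_symSections hσ)⟩

theorem ofSection_mem {k : NegInt} (σ : ∀ x, V.dualFiber k x) (hσ : IsDualSection σ) :
    ofSection σ hσ ∈ V.functionGrading (dualDeg k) :=
  gen_mem_symSections hσ

/-- In degree `0` the fibres consist of scalars, and the augmentation reads off the smooth function.
-/
theorem exists_eq_ofFun {a : V.functionAlgebra} (ha : a ∈ V.functionGrading 0) :
    ∃ g, a = ofFun g := by
  refine ⟨⟨fun x => GSym.augmentation dualDeg _ (a.1 x), fun x =>
    contMDiffAt_augmentation (ha.2 x)⟩, Subtype.ext (funext fun x => ?_)⟩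
  exact GSym.eq_algebraMap_of_mem_piece_zero isLocallyFiniteDeg_dualDeg (ha.1 x)

/-- The sections of the bundle of algebras that agree near `y` with polynomials in globally smooth
functions and sections of the dual bundles. -/
def polynomialNear (y : V.base) : Subalgebra ℝ (∀ x, GSym dualDeg (fun k => V.dualFiber k x)) where
  carrier := {s | ∃ t ∈ Algebra.adjoin ℝ (Set.range (ofFun (V := V)) ∪
    {a | ∃ (k : NegInt) (σ : ∀ x, V.dualFiber k x) (hσ : IsDualSection σ), a = ofSection σ hσ}),
    ∀ᶠ x in 𝓝 y, s x = t.1 x}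
  mul_mem' := by
    rintro a b ⟨t, ht, hat⟩ ⟨u, hu, hbu⟩
    refine ⟨t * u, mul_mem ht hu, ?_⟩
    filter_upwards [hat, hbu] with x h1 h2
    rw [Pi.mul_apply, h1, h2]
    rfl
  add_mem' := by
    rintro a b ⟨t, ht, hat⟩ ⟨u, hu, hbu⟩
    refine ⟨t + u, add_mem ht hu, ?_⟩
    filter_upwards [hat, hbu] with x h1 h2
    rw [Pi.add_apply, h1, h2]
    rfl
  algebraMap_mem' r := ⟨_, Subalgebra.algebraMap_mem _ r, Filter.Eventually.of_forall fun _ => rfl⟩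

theorem algebraMap_mem_polynomialNear {y : V.base} {s : Set V.base} (hs : s ∈ 𝓝 y)
    {c : V.base → ℝ} (hc : ∀ x ∈ s, ContMDiffAt (𝓡 V.dim) 𝓘(ℝ) ∞ c x) :
    (fun x => algebraMap ℝ _ (c x)) ∈ polynomialNear y := by
  obtain ⟨g, hg⟩ := exists_contMDiffMap_eventuallyEq hs hc
  refine ⟨ofFun g, Algebra.subset_adjoin (Or.inl ⟨g, rfl⟩), ?_⟩
  filter_upwards [hg] with x hx
  rw [ofFun_apply, hx]

theorem gen_mem_polynomialNear {y : V.base} {s : Set V.base} (hs : s ∈ 𝓝 y) {k : NegInt}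
    {σ : ∀ x, V.dualFiber k x} (hσ : ∀ x ∈ s, ContMDiffAt (𝓡 V.dim)
      ((𝓡 V.dim).prod 𝓘(ℝ, V.modelFiber k →L[ℝ] ℝ)) ∞
      (fun x => TotalSpace.mk' (V.modelFiber k →L[ℝ] ℝ) (E := V.dualFiber k) x (σ x)) x) :
    (fun x => GSym.gen dualDeg (W := fun k => V.dualFiber k x) k (σ x)) ∈ polynomialNear y := by
  obtain ⟨τ, hτ, hστ⟩ := exists_section_eventuallyEq hs hσ
  refine ⟨ofSection τ hτ, Algebra.subset_adjoin (Or.inr ⟨k, τ, hτ, rfl⟩), ?_⟩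
  filter_upwards [hστ] with x hx
  exact congrArg _ hx.symm

/-- Smooth sections of the bundle of algebras are locally polynomials in smooth functions and
sections of the dual bundles. -/
theorem mem_polynomialNear {n : ℤ} {s : ∀ x, GSym dualDeg (fun k => V.dualFiber k x)}
    (hs : s ∈ symSections dualDeg (𝓡 V.dim) (fun k => V.modelFiber k →L[ℝ] ℝ) V.dualFiber n)
    (y : V.base) : s ∈ polynomialNear y := by
  set F : NegInt → Type := fun k => V.modelFiber k →L[ℝ] ℝ
  have h := isLocallyFiniteDeg_dualDeg
  set U := symBaseSet dualDeg 1 F V.dualFiber n y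
  have hU : U ∈ 𝓝 y := (isOpen_symBaseSet F V.dualFiber h n y).mem_nhds
    (mem_symBaseSet dualDeg 1 F V.dualFiber n y)
  let s' : ∀ x, SymFiber F V.dualFiber h n x := fun x =>
    symFiberEquiv F V.dualFiber h n x ⟨s x, hs.1 x⟩
  let v := fun x => symCoord F V.dualFiber h n y x (s' x)
  have hv : ∀ x ∈ U, ContMDiffAt (𝓡 V.dim) 𝓘(ℝ, EuclideanSpace ℝ (Fin (symRank F dualDeg n))) ∞
      v x := fun x hx => contMDiffAt_symCoord (𝓡 V.dim) F V.dualFiber h n hx (hs.2 x)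
  -- The terms of the expansion of `s` in the local frame: the coordinates are smooth on all of `U`,
  -- and the frame members are polynomials in local dual sections. Hence every ingredient has a
  -- global extension.
  let P : Fin (symRank F dualDeg n) → ∀ x, GSym dualDeg (fun k => V.dualFiber k x) := fun j x =>
    algebraMap ℝ _ (v x j) * symOfModel dualDeg 1 F V.dualFiber n y x
      ((symModelEquiv F h n).symm (EuclideanSpace.single j 1))
  have hsum : ∀ᶠ x in 𝓝 y, s x = (∑ j, P j) x := by
    filter_upwards [hU] with x hx
    have h1 : s x = symFiberIncl F h n x (s' x) := rfl
    rw [h1, ← symOfCoord_symCoord F V.dualFiber h n hx (s' x), symFiberIncl_symOfCoord]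
    change symOfModel dualDeg 1 F V.dualFiber n y x ((symModelEquiv F h n).symm (v x)) = _
    conv_lhs => rw [← (EuclideanSpace.basisFun _ ℝ).sum_repr (v x)]
    simp [P, Finset.sum_apply, Algebra.smul_def]
  have hmem : ∑ j, P j ∈ polynomialNear y := by
    refine sum_mem fun j _ => mul_mem (a := fun x => algebraMap ℝ _ (v x j)) ?_ ?_
    · exact algebraMap_mem_polynomialNear hU fun x hx =>
        (EuclideanSpace.proj (𝕜 := ℝ) j).contMDiff.contMDiffAt.comp x (hv x hx)
    · refine symOfModel_mem _ n y (fun i hi w => ?_) _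
      have hy := mem_baseSet_trivializationAt (F i) (V.dualFiber i) y
      exact gen_mem_polynomialNear
        ((trivializationAt (F i) (V.dualFiber i) y).open_baseSet.mem_nhds hy)
        fun x hx => contMDiffAt_symmₗ (F := F) (E := V.dualFiber) hx w
  obtain ⟨t, ht, htt⟩ := hmem
  exact ⟨t, ht, by filter_upwards [hsum, htt] with x h1 h2; rw [h1, h2]⟩

/-- Two algebra morphisms on the function algebra that restrict to the evaluation at `y` on
functions and agree on the sections of the dual bundles are equal. -/
theorem functionAlgebra_algHom_ext {R : Type*} [Ring R] [Algebra ℝ R] (y : V.base)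
    {A B : V.functionAlgebra →ₐ[ℝ] R} (hA : ∀ g, A (ofFun g) = algebraMap ℝ R (g y))
    (hB : ∀ g, B (ofFun g) = algebraMap ℝ R (g y))
    (hAB : ∀ (k : NegInt) (σ : ∀ x, V.dualFiber k x) (hσ : IsDualSection σ),
      A (ofSection σ hσ) = B (ofSection σ hσ)) : A = B := by
  have key : ∀ (n : ℤ) (a : V.functionAlgebra), a ∈ V.functionGrading n → A a = B a := by
    intro n a ha
    obtain ⟨t, ht, hat⟩ := mem_polynomialNear ha y
    obtain ⟨f, hf1, hf⟩ := exists_bump (I := 𝓡 V.dim) hat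
    -- `a` and the polynomial `t` agree only near `y`. After multiplication by the bump function
    -- they agree globally, and both morphisms send the bump function to `f y = 1`.
    have hft : ofFun f * a = ofFun f * t := by
      apply Subtype.ext
      funext x
      change (ofFun f).1 x * a.1 x = (ofFun f).1 x * t.1 x
      by_cases hx : f x = 0
      · rw [ofFun_apply, hx, map_zero, zero_mul, zero_mul]
      · rw [show a.1 x = t.1 x from hf (subset_tsupport _ hx)]
    have hle : Algebra.adjoin ℝ (Set.range (ofFun (V := V)) ∪ {a | ∃ (k : NegInt)
        (σ : ∀ x, V.dualFiber k x) (hσ : IsDualSection σ), a = ofSection σ hσ}) ≤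
        AlgHom.equalizer A B := by
      refine Algebra.adjoin_le ?_
      rintro _ (⟨g, rfl⟩ | ⟨k, σ, hσ, rfl⟩)
      · exact (hA g).trans (hB g).symm
      · exact hAB k σ hσ
    have hA1 := congrArg A hft
    have hB1 := congrArg B hft
    rw [map_mul, map_mul, hA, hf1.self_of_nhds, map_one, one_mul, one_mul] at hA1
    rw [map_mul, map_mul, hB, hf1.self_of_nhds, map_one, one_mul, one_mul] at hB1
    rw [hA1, hB1]
    exact hle ht
  ext a
  have htop : (⨆ n, V.functionGrading n) = ⊤ :=
    (DirectSum.Decomposition.isInternal V.functionGrading).submodule_iSup_eq_top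
  have hle : ⨆ n, V.functionGrading n ≤ LinearMap.eqLocus A.toLinearMap B.toLinearMap :=
    iSup_le key
  rw [htop] at hle
  exact hle Submodule.mem_top

end NegGradedVectBundle

/-! ### The unit of the adjunction -/

namespace NegGradedVectBundle

/-- A graded algebra morphism between function algebras given by an algebra morphism between the
algebras of all sections that preserves the smooth sections of each degree. -/
def gradedAlgHomOfPi {V W : NegGradedVectBundle.{u}}
    (Φ : (∀ y, GSym dualDeg (fun k => W.dualFiber k y)) →ₐ[ℝ]
      (∀ x, GSym dualDeg (fun k => V.dualFiber k x)))
    (hΦ : ∀ n, ∀ s ∈ symSections dualDeg (𝓡 W.dim) (fun k => W.modelFiber k →L[ℝ] ℝ) W.dualFiber n,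
      Φ s ∈ symSections dualDeg (𝓡 V.dim) (fun k => V.modelFiber k →L[ℝ] ℝ) V.dualFiber n) :
    W.functionGrading →ₐᵍ[ℝ] V.functionGrading where
  toAlgHom := (Φ.comp W.functionAlgebra.val).codRestrict V.functionAlgebra fun s => by
    have h : (⨆ n, symSections dualDeg (𝓡 W.dim) (fun k => W.modelFiber k →L[ℝ] ℝ)
        W.dualFiber n).map Φ.toLinearMap ≤
        ⨆ n, symSections dualDeg (𝓡 V.dim) (fun k => V.modelFiber k →L[ℝ] ℝ) V.dualFiber n := by
      rw [Submodule.map_iSup]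
      refine iSup_mono fun n => ?_
      rintro _ ⟨t, ht, rfl⟩
      exact hΦ n t ht
    exact h ⟨s.1, s.2, rfl⟩
  map_mem {n s} hs := hΦ n s.1 hs

/-- An isomorphism of the duals of the bundles `D` with the homogeneous parts of the function
algebra bundle of `V`, under which the smooth sections correspond. -/
structure BundlesOver.DualEquiv {V : NegGradedVectBundle.{u}} (D : BundlesOver V) where
  equiv : ∀ (k : NegInt) (x : V.base), D.total.dualFiber k x ≃ₗ[ℝ]
    GSym.piece dualDeg (fun j => V.dualFiber j x) (dualDeg k)
  smooth_iff : ∀ (k : NegInt) (σ : ∀ x, D.total.dualFiber k x) (x₀ : V.base),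
    ContMDiffAt (𝓡 V.dim) ((𝓡 V.dim).prod 𝓘(ℝ, D.total.modelFiber k →L[ℝ] ℝ)) ∞
      (fun x => TotalSpace.mk' (D.total.modelFiber k →L[ℝ] ℝ) (E := D.total.dualFiber k)
        x (σ x)) x₀ ↔
    (fun x => (equiv k x (σ x) : GSym dualDeg (fun j => V.dualFiber j x))) ∈
      symSmoothAt dualDeg (𝓡 V.dim) (fun k => V.modelFiber k →L[ℝ] ℝ) V.dualFiber x₀

namespace BundlesOver.DualEquiv

variable {V : NegGradedVectBundle.{u}} {D : BundlesOver V} (ψ : D.DualEquiv)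

/-- The fibrewise algebra morphism that extends `ψ`. -/
def unitFiber (x : V.base) : GSym dualDeg (fun k => D.total.dualFiber k x) →ₐ[ℝ]
    GSym dualDeg (fun k => V.dualFiber k x) :=
  GSym.lift dualDeg (fun k => Submodule.subtype _ ∘ₗ (ψ.equiv k x).toLinearMap)
    fun _ _ v w => GSym.mul_comm_of_mem dualDeg (ψ.equiv _ x v).2 (ψ.equiv _ x w).2

theorem unitFiber_gen (x : V.base) (k : NegInt) (ξ : D.total.dualFiber k x) :
    ψ.unitFiber x (GSym.gen dualDeg k ξ) = ψ.equiv k x ξ := by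
  simp [unitFiber]

/-- The unit of the adjunction, on the level of functions. -/
def unit : D.total.functionGrading →ₐᵍ[ℝ] V.functionGrading :=
  gradedAlgHomOfPi (V := V) (W := D.total)
    (AlgHom.pi fun x => (ψ.unitFiber x).comp (Pi.evalAlgHom ℝ _ x)) fun n s hs => by
      refine ⟨fun x => ?_, fun x => ?_⟩
      · have h := GSym.lift_mem (𝒜 := GSym.piece dualDeg (fun k => V.dualFiber k x)) 1
          (f := fun k => Submodule.subtype _ ∘ₗ (ψ.equiv k x).toLinearMap)
          (hf := fun _ _ v w => GSym.mul_comm_of_mem dualDeg (ψ.equiv _ x v).2 (ψ.equiv _ x w).2)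
          (fun k v => by rw [one_mul]; exact (ψ.equiv k x v).2) (hs.1 x)
        rwa [one_mul] at h
      · refine mem_symSmoothAt_of_generators (I := 𝓡 V.dim) ψ.unitFiber (fun k σ hσ => ?_) (hs.2 x)
        simp only [unitFiber_gen]
        exact (ψ.smooth_iff k σ x).1 hσ

end BundlesOver.DualEquiv

/-! ### Base map and locality of a morphism of function algebras -/

variable {W : NegGradedVectBundle.{u}}

/-- The coordinate functionals of the trivialization, with their germs at `y₀` extended to global
sections. -/
theorem exists_dual_frame (k : NegInt) (y₀ : W.base) :
    ∃ τ : Fin (W.rank k) → ∀ y, W.dualFiber k y, (∀ i, IsDualSection (τ i)) ∧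
      ∀ᶠ y in 𝓝 y₀, ∀ i v, (τ i y v : ℝ) =
        (trivializationAt (W.modelFiber k) (W.fiber k) y₀).continuousLinearMapAt ℝ y v i := by
  set e := trivializationAt (W.modelFiber k) (W.fiber k) y₀
  have hy₀ : y₀ ∈ e.baseSet := mem_baseSet_trivializationAt _ _ _
  let τ₀ : Fin (W.rank k) → ∀ y, W.dualFiber k y := fun i y =>
    (EuclideanSpace.proj i : W.modelFiber k →L[ℝ] ℝ).comp (e.continuousLinearMapAt ℝ y)
  have h : ∀ i, ∃ τ : ∀ y, W.dualFiber k y, IsDualSection τ ∧ ∀ᶠ y in 𝓝 y₀, τ y = τ₀ i y := by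
    intro i
    refine exists_section_eventuallyEq (I := 𝓡 W.dim) (e.open_baseSet.mem_nhds hy₀) fun y hy => ?_
    refine contMDiffAt_dual_of_apply fun w hw => ?_
    rw [Trivialization.contMDiffAt_section_iff e hy] at hw
    refine ((EuclideanSpace.proj (𝕜 := ℝ) i).contMDiff.contMDiffAt.comp y hw).congr_of_eventuallyEq
      ?_
    filter_upwards [e.open_baseSet.mem_nhds hy] with z hz
    simp [τ₀, Trivialization.linearMapAt_apply, hz]
  choose τ hτ hττ using h
  refine ⟨τ, hτ, ?_⟩
  filter_upwards [Filter.eventually_all.2 hττ] with y hy i v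
  rw [hy]
  rfl

variable {V : NegGradedVectBundle.{u}}

/-- Composing `Φ` on functions with the augmentation at `x` gives a character, hence a point `φ x`.
Each `g ∘ φ` is the smooth function representing the degree `0` element `Φ (ofFun g)`, so `φ` is
smooth. -/
theorem exists_pullback_map (Φ : W.functionGrading →ₐᵍ[ℝ] V.functionGrading) :
    ∃ φ : V.base → W.base, ContMDiff (𝓡 V.dim) (𝓡 W.dim) ∞ φ ∧
      ∀ (g : W.SmoothFun) (x : V.base), (Φ (ofFun g)).1 x = algebraMap ℝ _ (g (φ x)) := by
  have hχ : ∀ x : V.base, ∃ p : W.base, ∀ g : W.SmoothFun,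
      GSym.augmentation dualDeg _ ((Φ (ofFun g)).1 x) = g p := fun x =>
    exists_eq_eval_of_character ((((GSym.augmentation dualDeg _).comp
      (Pi.evalAlgHom ℝ (fun x => GSym dualDeg (fun k => V.dualFiber k x)) x)).comp
        V.functionAlgebra.val).comp (Φ.toAlgHom.comp ofFun))
  choose φ hφ using hχ
  have hg : ∀ g : W.SmoothFun, ∃ g' : V.SmoothFun, Φ (ofFun g) = ofFun g' := fun g =>
    exists_eq_ofFun (Φ.map_mem (ofFun_mem g))
  choose g' hg' using hg
  have hgφ : ∀ (g : W.SmoothFun) x, g' g x = g (φ x) := by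
    intro g x
    rw [← hφ, hg', ofFun_apply, AlgHom.commutes]
    rfl
  refine ⟨φ, contMDiff_of_comp_contMDiffMap (I := 𝓡 W.dim) fun g => ?_, fun g x => ?_⟩
  · rw [show g ∘ φ = g' g from funext fun x => (hgφ g x).symm]
    exact (g' g).contMDiff
  · rw [hg', ofFun_apply, hgφ]

/-- Locality of `Φ`: a bump function at `φ x` makes the two elements agree globally, and its image
has value `1` at `x`. -/
theorem apply_eq_of_eventuallyEq {Φ : W.functionGrading →ₐᵍ[ℝ] V.functionGrading} {φ : V.base → W.base}
    (hφ : ∀ (g : W.SmoothFun) (x : V.base), (Φ (ofFun g)).1 x = algebraMap ℝ _ (g (φ x)))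
    {x : V.base} {a b : W.functionAlgebra} (hab : ∀ᶠ y in 𝓝 (φ x), a.1 y = b.1 y) :
    (Φ a).1 x = (Φ b).1 x := by
  obtain ⟨f, hf1, hf⟩ := exists_bump (I := 𝓡 W.dim) hab
  have hft : ofFun f * a = ofFun f * b := by
    apply Subtype.ext
    funext y
    change (ofFun f).1 y * a.1 y = (ofFun f).1 y * b.1 y
    by_cases hy : f y = 0
    · rw [ofFun_apply, hy, map_zero, zero_mul, zero_mul]
    · rw [show a.1 y = b.1 y from hf (subset_tsupport _ hy)]
  have h1 := congrArg (fun c => (Φ c).1 x) hft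
  simp only [map_mul] at h1
  change (Φ (ofFun f)).1 x * (Φ a).1 x = (Φ (ofFun f)).1 x * (Φ b).1 x at h1
  rwa [hφ, hf1.self_of_nhds, map_one, one_mul, one_mul] at h1

/-- The value of a graded algebra morphism on a section of a dual bundle is determined by the values
on a frame. -/
theorem apply_ofSection_eq_sum {Φ : W.functionGrading →ₐᵍ[ℝ] V.functionGrading}
    {φ : V.base → W.base}
    (hφ : ∀ (g : W.SmoothFun) (x : V.base), (Φ (ofFun g)).1 x = algebraMap ℝ _ (g (φ x)))
    {k : NegInt} {x : V.base} {τ : Fin (W.rank k) → ∀ y, W.dualFiber k y}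
    (hτ : ∀ i, IsDualSection (τ i))
    (hττ : ∀ᶠ y in 𝓝 (φ x), ∀ i v, (τ i y v : ℝ) =
      (trivializationAt (W.modelFiber k) (W.fiber k) (φ x)).continuousLinearMapAt ℝ y v i)
    {σ : ∀ y, W.dualFiber k y} (hσ : IsDualSection σ) :
    (Φ (ofSection σ hσ)).1 x = ∑ i, (σ (φ x) ((trivializationAt (W.modelFiber k) (W.fiber k)
      (φ x)).symmL ℝ (φ x) (EuclideanSpace.single i 1)) : ℝ) • (Φ (ofSection (τ i) (hτ i))).1 x := by
  set e := trivializationAt (W.modelFiber k) (W.fiber k) (φ x)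
  have hx : φ x ∈ e.baseSet := mem_baseSet_trivializationAt _ _ _
  -- The coefficients of `σ` in the dual frame `τ`, made global. By locality `σ` may then be
  -- replaced by the combination of the `τ i` with these coefficients.
  have hc : ∀ i, ∃ g : W.SmoothFun, ∀ᶠ y in 𝓝 (φ x),
      g y = (σ y (e.symmL ℝ y (EuclideanSpace.single i 1)) : ℝ) := by
    intro i
    refine exists_contMDiffMap_eventuallyEq (I := 𝓡 W.dim) (e.open_baseSet.mem_nhds hx)
      fun y hy => ?_
    refine (contMDiffAt_dual_apply (hσ y) (contMDiffAt_symm_trivialization hy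
      (EuclideanSpace.single i 1))).congr_of_eventuallyEq ?_
    filter_upwards [e.open_baseSet.mem_nhds hy] with z hz
    rw [Trivialization.symmL_apply _ hz]
  choose g hg using hc
  have h1 : (Φ (ofSection σ hσ)).1 x =
      (Φ (∑ i, ofFun (g i) * ofSection (τ i) (hτ i))).1 x := by
    refine apply_eq_of_eventuallyEq hφ ?_
    filter_upwards [hττ, Filter.eventually_all.2 hg, e.open_baseSet.mem_nhds hx] with y h1 h2 hy
    have hval : (∑ i, ofFun (g i) * ofSection (τ i) (hτ i) : W.functionAlgebra).1 y =
        ∑ i, algebraMap ℝ _ (g i y) * GSym.gen dualDeg (W := fun k => W.dualFiber k y) k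
          (τ i y) := by
      rw [AddSubmonoidClass.coe_finsetSum, Finset.sum_apply]
      rfl
    rw [hval]
    change GSym.gen dualDeg (W := fun k => W.dualFiber k y) k (σ y) = _
    simp only [← Algebra.smul_def, ← map_smul, ← map_sum]
    congr 1
    ext v
    rw [sum_apply]
    conv_lhs => rw [← e.symmL_continuousLinearMapAt (R := ℝ) hy v,
      ← (EuclideanSpace.basisFun _ ℝ).sum_repr (e.continuousLinearMapAt ℝ y v), map_sum, map_sum]
    refine Finset.sum_congr rfl fun i _ => ?_
    rw [map_smul, map_smul]
    change _ = g i y • (τ i y v : ℝ)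
    rw [h1, h2, smul_eq_mul, mul_comm, EuclideanSpace.basisFun_apply, EuclideanSpace.basisFun_repr]
    rfl
  rw [h1, map_sum, AddSubmonoidClass.coe_finsetSum, Finset.sum_apply]
  refine Finset.sum_congr rfl fun i _ => ?_
  rw [map_mul]
  change (Φ (ofFun (g i))).1 x * _ = _
  rw [hφ, ← Algebra.smul_def, (hg i).self_of_nhds]

end NegGradedVectBundle

/-! ### Universal property of the unit -/

namespace NegGradedVectBundle

variable {V W : NegGradedVectBundle.{u}}

namespace BundlesOver.DualEquiv

variable {D : BundlesOver V} (ψ : D.DualEquiv)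

/-- The section of the dual of `D` that corresponds to the image of a section of a dual bundle of
`W` under a morphism of function algebras. -/
def sectionImage (Φ : W.functionGrading →ₐᵍ[ℝ] V.functionGrading) {k : NegInt}
    (σ : ∀ y, W.dualFiber k y) (hσ : IsDualSection σ) (x : V.base) : D.total.dualFiber k x :=
  (ψ.equiv k x).symm ⟨(Φ (ofSection σ hσ)).1 x, (Φ.map_mem (ofSection_mem σ hσ)).1 x⟩

theorem equiv_sectionImage (Φ : W.functionGrading →ₐᵍ[ℝ] V.functionGrading) {k : NegInt}
    (σ : ∀ y, W.dualFiber k y) (hσ : IsDualSection σ) (x : V.base) :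
    (ψ.equiv k x (ψ.sectionImage Φ σ hσ x) : GSym dualDeg (fun j => V.dualFiber j x)) =
      (Φ (ofSection σ hσ)).1 x := by
  rw [sectionImage, LinearEquiv.apply_symm_apply]

theorem isDualSection_sectionImage (Φ : W.functionGrading →ₐᵍ[ℝ] V.functionGrading) {k : NegInt}
    (σ : ∀ y, W.dualFiber k y) (hσ : IsDualSection σ) :
    IsDualSection (V := D.total) (ψ.sectionImage Φ σ hσ) := by
  intro x
  refine (ψ.smooth_iff k _ x).2 ?_
  simp only [equiv_sectionImage]
  exact (Φ.map_mem (ofSection_mem σ hσ)).2 x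

theorem sectionImage_eq_sum {Φ : W.functionGrading →ₐᵍ[ℝ] V.functionGrading}
    {φ : V.base → W.base}
    (hφ : ∀ (g : W.SmoothFun) (x : V.base), (Φ (ofFun g)).1 x = algebraMap ℝ _ (g (φ x)))
    {k : NegInt} {x : V.base} {τ : Fin (W.rank k) → ∀ y, W.dualFiber k y}
    (hτ : ∀ i, IsDualSection (τ i))
    (hττ : ∀ᶠ y in 𝓝 (φ x), ∀ i v, (τ i y v : ℝ) =
      (trivializationAt (W.modelFiber k) (W.fiber k) (φ x)).continuousLinearMapAt ℝ y v i)
    {σ : ∀ y, W.dualFiber k y} (hσ : IsDualSection σ) :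
    ψ.sectionImage Φ σ hσ x = ∑ i, (σ (φ x) ((trivializationAt (W.modelFiber k) (W.fiber k)
      (φ x)).symmL ℝ (φ x) (EuclideanSpace.single i 1)) : ℝ) • ψ.sectionImage Φ (τ i) (hτ i) x := by
  apply (ψ.equiv k x).injective
  apply Subtype.ext
  simp only [map_sum, map_smul, AddSubmonoidClass.coe_finsetSum, SetLike.val_smul,
    equiv_sectionImage]
  exact apply_ofSection_eq_sum hφ hτ hττ hσ

/-- A morphism of function algebras induces fibrewise linear maps. -/
theorem exists_fiberMap {Φ : W.functionGrading →ₐᵍ[ℝ] V.functionGrading} {φ : V.base → W.base}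
    (hφ : ∀ (g : W.SmoothFun) (x : V.base), (Φ (ofFun g)).1 x = algebraMap ℝ _ (g (φ x)))
    (k : NegInt) (x : V.base) :
    ∃ f : D.fiber k x →L[ℝ] W.fiber k (φ x), ∀ (σ : ∀ y, W.dualFiber k y) (hσ : IsDualSection σ)
      (v : D.fiber k x), (σ (φ x) (f v) : ℝ) = ψ.sectionImage Φ σ hσ x v := by
  obtain ⟨τ, hτ, hττ⟩ := exists_dual_frame k (φ x)
  let e := trivializationAt (W.modelFiber k) (W.fiber k) (φ x)
  -- The coordinates of the sought vector are the values required by the frame `τ`; every other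
  -- section then follows from `sectionImage_eq_sum`.
  let L : D.fiber k x →L[ℝ] W.modelFiber k :=
    ∑ i, ContinuousLinearMap.smulRight (ψ.sectionImage Φ (τ i) (hτ i) x : D.fiber k x →L[ℝ] ℝ)
      (EuclideanSpace.single i 1)
  refine ⟨(e.symmL ℝ (φ x)).comp L, fun σ hσ v => ?_⟩
  rw [ψ.sectionImage_eq_sum hφ hτ hττ hσ]
  simp only [L, ContinuousLinearMap.comp_apply, sum_apply,
    ContinuousLinearMap.smulRight_apply, map_sum, map_smul]
  refine Finset.sum_congr rfl fun i _ => ?_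
  exact mul_comm _ _

/-- In the trivialization around `φ p₀.1` the components of the map are evaluations of the smooth
dual sections `ψ.sectionImage Φ (τ i) (hτ i)`, which are smooth functions on the total space. -/
theorem contMDiff_fiberMap {Φ : W.functionGrading →ₐᵍ[ℝ] V.functionGrading} {φ : V.base → W.base}
    (hφs : ContMDiff (𝓡 V.dim) (𝓡 W.dim) ∞ φ) {k : NegInt}
    {f : ∀ x, D.fiber k x →L[ℝ] W.fiber k (φ x)}
    (hf : ∀ x (σ : ∀ y, W.dualFiber k y) (hσ : IsDualSection σ)
      (v : D.fiber k x), (σ (φ x) (f x v) : ℝ) = ψ.sectionImage Φ σ hσ x v) :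
    ContMDiff ((𝓡 V.dim).prod 𝓘(ℝ, D.total.modelFiber k))
      ((𝓡 W.dim).prod 𝓘(ℝ, W.modelFiber k)) ∞
      (fun p : TotalSpace (D.total.modelFiber k) (D.fiber k) =>
        TotalSpace.mk' (W.modelFiber k) (φ p.1) (f p.1 p.2)) := by
  intro p₀
  obtain ⟨τ, hτ, hττ⟩ := exists_dual_frame k (φ p₀.1)
  have hproj := contMDiff_proj (n := ∞) (IB := 𝓡 V.dim) (F := D.total.modelFiber k) (D.fiber k)
  have hbase : ContMDiff ((𝓡 V.dim).prod 𝓘(ℝ, D.total.modelFiber k)) (𝓡 W.dim) ∞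
    (fun p : TotalSpace (D.total.modelFiber k) (D.fiber k) => φ p.1) := hφs.comp hproj
  refine contMDiffAt_totalSpace.2 ⟨hbase p₀, ?_⟩
  have hcoord : ∀ i, ContMDiffAt ((𝓡 V.dim).prod 𝓘(ℝ, D.total.modelFiber k)) 𝓘(ℝ) ∞
      (fun p : TotalSpace (D.total.modelFiber k) (D.fiber k) =>
        (ψ.sectionImage Φ (τ i) (hτ i) p.1 p.2 : ℝ)) p₀ := by
    intro i
    have h1 : ContMDiffAt ((𝓡 V.dim).prod 𝓘(ℝ, D.total.modelFiber k))
        ((𝓡 V.dim).prod 𝓘(ℝ, D.total.modelFiber k →L[ℝ] ℝ)) ∞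
        (fun p : TotalSpace (D.total.modelFiber k) (D.fiber k) =>
          TotalSpace.mk' (D.total.modelFiber k →L[ℝ] ℝ) (E := D.total.dualFiber k) p.1
            (ψ.sectionImage Φ (τ i) (hτ i) p.1)) p₀ :=
      (ψ.isDualSection_sectionImage Φ (τ i) (hτ i) p₀.1).comp p₀ (hproj p₀)
    have h2 := h1.clm_bundle_apply (v := fun p => p.2) contMDiffAt_id
    exact (contMDiffAt_totalSpace.1 h2).2
  have hsum : ContMDiffAt ((𝓡 V.dim).prod 𝓘(ℝ, D.total.modelFiber k)) 𝓘(ℝ, W.modelFiber k) ∞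
      (fun p : TotalSpace (D.total.modelFiber k) (D.fiber k) =>
        ∑ i, (ψ.sectionImage Φ (τ i) (hτ i) p.1 p.2 : ℝ) •
          (EuclideanSpace.single i 1 : W.modelFiber k)) p₀ :=
    ContMDiffAt.sum fun i _ => (hcoord i).smul contMDiffAt_const
  refine hsum.congr_of_eventuallyEq ?_
  filter_upwards [(hbase.continuous.continuousAt (x := p₀)).eventually hττ,
    (hbase.continuous.continuousAt (x := p₀)).eventually
      ((trivializationAt (W.modelFiber k) (W.fiber k) (φ p₀.1)).open_baseSet.mem_nhds
        (mem_baseSet_trivializationAt _ _ _))] with p h1 h2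
  have h3 : ∀ i, (ψ.sectionImage Φ (τ i) (hτ i) p.1 p.2 : ℝ) =
      (trivializationAt (W.modelFiber k) (W.fiber k) (φ p₀.1) ⟨φ p.1, f p.1 p.2⟩).2 i := by
    intro i
    have h4 : φ p.1 ∈ (trivializationAt (W.modelFiber k) (W.fiber k) (φ p₀.1)).baseSet := h2
    rw [← hf, h1]
    simp [Trivialization.linearMapAt_apply, h4]
  simp only [h3]
  conv_lhs => rw [← (EuclideanSpace.basisFun _ ℝ).sum_repr
    (trivializationAt (W.modelFiber k) (W.fiber k) (φ p₀.1) ⟨φ p.1, f p.1 p.2⟩).2]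
  simp

/-- The base map and the fibre maps extracted from `Φ` form a bundle morphism. Its composite with
the unit agrees with `Φ` on functions and dual sections, hence everywhere. -/
theorem exists_unit_comp (Φ : W.functionGrading →ₐᵍ[ℝ] V.functionGrading) :
    ∃ f : Hom D.total W, ψ.unit.comp (functionMap f) = Φ := by
  obtain ⟨φ, hφs, hφ⟩ := exists_pullback_map Φ
  choose f hf using fun k x => ψ.exists_fiberMap hφ k x
  let F : Hom D.total W :=
    { onBase := φ
      contMDiff_onBase := hφs
      onFiber := f
      contMDiff_onFiber := fun k => ψ.contMDiff_fiberMap hφs (hf k) }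
  refine ⟨F, ?_⟩
  apply GradedAlgHom.coe_fn_injective
  funext a
  apply Subtype.ext
  funext x
  let ev := (Pi.evalAlgHom ℝ (fun x => GSym dualDeg (fun k => V.dualFiber k x)) x).comp
    V.functionAlgebra.val
  have h : ev.comp (ψ.unit.comp (functionMap F)).toAlgHom = ev.comp Φ.toAlgHom := by
    refine functionAlgebra_algHom_ext (φ x) (fun g => ?_) (fun g => hφ g x) fun k σ hσ => ?_
    · change ψ.unitFiber x (GSym.map dualDeg _ (algebraMap ℝ _ (g (φ x)))) = _
      rw [AlgHom.commutes, AlgHom.commutes]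
    · change ψ.unitFiber x (GSym.map dualDeg (fun k => dualMap F k x)
        (GSym.gen dualDeg k (σ (φ x)))) = (Φ (ofSection σ hσ)).1 x
      -- Both sides are now images under `ψ.equiv k x` of covectors on `D.fiber k x`, and their
      -- equality is the defining property `hf` of the fibre map.
      rw [GSym.map_gen, unitFiber_gen, ← ψ.equiv_sectionImage]
      congr 2
      ext v
      exact hf k x σ hσ v
  exact DFunLike.congr_fun h a

/-- Functions on the base of `W` separate points and so recover the base map. Dual frames separate
vectors, and `ψ` is injective, so the fibre maps are recovered as well. -/
theorem unit_comp_injective {f g : Hom D.total W}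
    (h : ψ.unit.comp (functionMap f) = ψ.unit.comp (functionMap g)) : f = g := by
  have hval : ∀ (a : W.functionAlgebra) (x : V.base),
      ψ.unitFiber x (GSym.map dualDeg (fun k => dualMap f k x) (a.1 (f.onBase x))) =
      ψ.unitFiber x (GSym.map dualDeg (fun k => dualMap g k x) (a.1 (g.onBase x))) := fun a x =>
    congrFun (congrArg Subtype.val (DFunLike.congr_fun h a)) x
  have hbase : f.onBase = g.onBase := by
    funext x
    by_contra hne
    -- `b` is `1` at `f.onBase x` and supported away from `g.onBase x`, which contradicts the
    -- equality of the two pullbacks of `b` at `x`.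
    obtain ⟨b, hb1, hb⟩ := exists_bump (I := 𝓡 W.dim) (isOpen_ne.mem_nhds hne)
    have h1 := hval (ofFun b) x
    rw [ofFun_apply, ofFun_apply, AlgHom.commutes, AlgHom.commutes, AlgHom.commutes,
      AlgHom.commutes] at h1
    have h2 := congrArg (GSym.augmentation dualDeg _) h1
    rw [AlgHom.commutes, AlgHom.commutes, hb1.self_of_nhds] at h2
    have h3 : b (g.onBase x) ≠ 0 := by
      intro h0
      rw [h0] at h2
      exact one_ne_zero h2
    exact hb (subset_tsupport _ h3) rfl
  -- The types of the fibre maps depend on the base maps, so these must be identified before the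
  -- fibre maps can be compared.
  obtain ⟨φ, hφ, f, hf⟩ := f
  obtain ⟨φ', hφ', g, hg⟩ := g
  obtain rfl : φ = φ' := hbase
  set F : Hom D.total W := ⟨φ, hφ, f, hf⟩ with hF
  set G : Hom D.total W := ⟨φ, hφ', g, hg⟩ with hG
  suffices hfg : f = g by subst hfg; rfl
  funext k x
  obtain ⟨τ, hτ, hττ⟩ := exists_dual_frame k (φ x)
  ext v
  have hx : φ x ∈ (trivializationAt (W.modelFiber k) (W.fiber k) (φ x)).baseSet :=
    mem_baseSet_trivializationAt _ _ _
  have key : ∀ i, (τ i (φ x) (f k x v) : ℝ) = τ i (φ x) (g k x v) := by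
    intro i
    have h1 := hval (ofSection (τ i) (hτ i)) x
    change ψ.unitFiber x (GSym.map dualDeg (fun k => dualMap F k x)
        (GSym.gen dualDeg (W := fun k => W.dualFiber k (φ x)) k (τ i (φ x)))) =
      ψ.unitFiber x (GSym.map dualDeg (fun k => dualMap G k x)
        (GSym.gen dualDeg (W := fun k => W.dualFiber k (φ x)) k (τ i (φ x)))) at h1
    rw [GSym.map_gen, GSym.map_gen, unitFiber_gen, unitFiber_gen] at h1
    exact DFunLike.congr_fun ((ψ.equiv k x).injective (Subtype.ext h1)) v
  have h2 : (trivializationAt (W.modelFiber k) (W.fiber k) (φ x)).continuousLinearMapAt ℝ (φ x)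
      (f k x v) = (trivializationAt (W.modelFiber k) (W.fiber k) (φ x)).continuousLinearMapAt ℝ
      (φ x) (g k x v) := by
    ext i
    rw [← hττ.self_of_nhds, ← hττ.self_of_nhds, key]
  rw [← Trivialization.symmL_continuousLinearMapAt (R := ℝ) _ hx (f k x v), h2,
    Trivialization.symmL_continuousLinearMapAt (R := ℝ) _ hx]

end BundlesOver.DualEquiv

end NegGradedVectBundle

/-! ### Isomorphisms of graded vector bundles and of N-manifolds -/

namespace NegGradedVectBundle

/-- The map of total spaces in degree `k` of a morphism of graded vector bundles. -/
def totalMap {V W : NegGradedVectBundle.{u}} (f : V ⟶ W) (k : NegInt)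
    (p : TotalSpace (V.modelFiber k) (V.fiber k)) : TotalSpace (W.modelFiber k) (W.fiber k) :=
  TotalSpace.mk' (W.modelFiber k) (f.onBase p.1) (f.onFiber k p.1 p.2)

/-- Working on total spaces avoids transport between the fibres over `g.onBase (f.onBase x)` and
over `x`, which agree only propositionally. -/
theorem totalMap_totalMap {V W : NegGradedVectBundle.{u}} {f : V ⟶ W} {g : W ⟶ V}
    (h : f ≫ g = 𝟙 V) (k : NegInt) (p : TotalSpace (V.modelFiber k) (V.fiber k)) :
    totalMap g k (totalMap f k p) = p := by
  change totalMap (f ≫ g) k p = p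
  rw [h]
  rfl

theorem onBase_onBase {V W : NegGradedVectBundle.{u}} {f : V ⟶ W} {g : W ⟶ V}
    (h : f ≫ g = 𝟙 V) (x : V.base) : g.onBase (f.onBase x) = x := by
  change (f ≫ g : V ⟶ V).onBase x = x
  rw [h]
  rfl

theorem bijective_onFiber {V W : NegGradedVectBundle.{u}} (i : V ≅ W) (k : NegInt) (x : V.base) :
    Function.Bijective (i.hom.onFiber k x) := by
  constructor
  · intro v w h
    have h1 : totalMap i.hom k ⟨x, v⟩ = totalMap i.hom k ⟨x, w⟩ := by
      simp only [totalMap, h]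
    have h2 := congrArg (totalMap i.inv k) h1
    rw [totalMap_totalMap i.hom_inv_id, totalMap_totalMap i.hom_inv_id] at h2
    exact TotalSpace.mk_injective x h2
  · intro w
    have h1 := totalMap_totalMap i.inv_hom_id k ⟨i.hom.onBase x, w⟩
    have h2 : ∃ v, totalMap i.inv k ⟨i.hom.onBase x, w⟩ = ⟨x, v⟩ := by
      have h3 : (totalMap i.inv k ⟨i.hom.onBase x, w⟩).1 = x := onBase_onBase i.hom_inv_id x
      generalize totalMap i.inv k ⟨i.hom.onBase x, w⟩ = p at h3
      obtain ⟨y, v⟩ := p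
      obtain rfl : y = x := h3
      exact ⟨v, rfl⟩
    obtain ⟨v, hv⟩ := h2
    rw [hv] at h1
    exact ⟨v, TotalSpace.mk_injective _ h1⟩

/-- An isomorphism of graded vector bundles is a diffeomorphism of the bases. -/
def diffeomorphOfIso {V W : NegGradedVectBundle.{u}} (i : V ≅ W) :
    V.base ≃ₘ^∞⟮𝓡 V.dim, 𝓡 W.dim⟯ W.base where
  toFun := i.hom.onBase
  invFun := i.inv.onBase
  left_inv := onBase_onBase i.hom_inv_id
  right_inv := onBase_onBase i.inv_hom_id
  contMDiff_toFun := i.hom.contMDiff_onBase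
  contMDiff_invFun := i.inv.contMDiff_onBase

/-- Smoothness is carried across by the total map of `i.hom` in one direction and of `i.inv` in the
other. -/
theorem _root_.IsReducedSymmetricBundle.of_iso {V E E' : NegGradedVectBundle.{u}}
    (h : IsReducedSymmetricBundle V E) (i : E ≅ E') : IsReducedSymmetricBundle V E' := by
  obtain ⟨φ, θ, hθ⟩ := h
  refine ⟨φ.trans (diffeomorphOfIso i), fun k x => (θ k x).trans
    (LinearEquiv.ofBijective (i.hom.onFiber k (φ x)).toLinearMap (bijective_onFiber i k (φ x))),
    fun k s x₀ => ?_⟩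
  rw [hθ]
  constructor
  · intro h
    exact (i.hom.contMDiff_onFiber k).contMDiffAt.comp x₀ h
  · intro h
    have h1 := (i.inv.contMDiff_onFiber k).contMDiffAt.comp x₀ h
    refine h1.congr_of_eventuallyEq (Filter.Eventually.of_forall fun x => ?_)
    exact (totalMap_totalMap i.hom_inv_id k ⟨φ x, θ k x (s x)⟩).symm

end NegGradedVectBundle

/-- An isomorphism of the graded algebras of functions is an isomorphism of N-manifolds. -/
def NManifold.isoOfAlgEquiv {X Y : NManifold.{u}} (e : X.functions ≃ₐ[ℝ] Y.functions)
    (he : ∀ n a, a ∈ X.grading n ↔ e a ∈ Y.grading n) : X ≅ Y where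
  hom :=
    { toAlgHom := e.symm.toAlgHom
      map_mem := fun {n a} ha => (he n _).2 (by simpa using ha) }
  inv :=
    { toAlgHom := e.toAlgHom
      map_mem := fun {n a} ha => (he n a).1 ha }
  hom_inv_id := by
    apply GradedAlgHom.coe_fn_injective
    funext a
    exact e.symm_apply_apply a
  inv_hom_id := by
    apply GradedAlgHom.coe_fn_injective
    funext a
    exact e.apply_symm_apply a

/-! ### Corepresentability and the adjunction -/

namespace NegGradedVectBundle

/-- The universal morphism from `𝔖(V)` to `𝔖(S^{≥ 1}(V))`. -/
def BundlesOver.DualEquiv.unitHom {V : NegGradedVectBundle.{u}} {D : BundlesOver V}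
    (ψ : D.DualEquiv) : splitNManifold.obj V ⟶ splitNManifold.obj D.total :=
  ψ.unit

theorem BundlesOver.DualEquiv.bijective_unitHom_comp {V W : NegGradedVectBundle.{u}}
    {D : BundlesOver V} (ψ : D.DualEquiv) :
    Function.Bijective fun f : D.total ⟶ W => ψ.unitHom ≫ splitNManifold.map f :=
  ⟨fun _ _ h => ψ.unit_comp_injective h, fun Φ => ψ.exists_unit_comp Φ⟩

/-- The graded vector bundle `S^{≥ 1}(V)` corepresents the functor that sends `W` to the set of
morphisms from `𝔖(V)` to `𝔖(W)`. -/
def BundlesOver.DualEquiv.corepresentableBy {V : NegGradedVectBundle.{u}} {D : BundlesOver V}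
    (ψ : D.DualEquiv) {X : NManifold.{u}} (i : X ≅ splitNManifold.obj V) :
    (splitNManifold ⋙ coyoneda.obj (Opposite.op X)).CorepresentableBy D.total where
  homEquiv := (Equiv.ofBijective _ ψ.bijective_unitHom_comp).trans i.symm.homFromEquiv
  homEquiv_comp g f := by
    change i.hom ≫ ψ.unitHom ≫ splitNManifold.map (f ≫ g) =
      (i.hom ≫ ψ.unitHom ≫ splitNManifold.map f) ≫ splitNManifold.map g
    rw [Functor.map_comp, Category.assoc, Category.assoc]

/-- Both properties are recorded for the same `E`, and for an arbitrary splitting of `X`, so that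
uniqueness of corepresenting objects applies to every splitting. -/
theorem exists_corepresentableBy {V : NegGradedVectBundle.{u}} {X : NManifold.{u}}
    (i : X ≅ splitNManifold.obj V) : ∃ E : NegGradedVectBundle.{u},
    IsReducedSymmetricBundle V E ∧
    Nonempty ((splitNManifold ⋙ coyoneda.obj (Opposite.op X)).CorepresentableBy E) := by
  obtain ⟨D, hD⟩ := exists_isSymmetric V
  obtain ⟨ψ, hψ⟩ := hD.exists_dual_equiv
  exact ⟨D.total, hD.isReducedSymmetricBundle,
    ⟨BundlesOver.DualEquiv.corepresentableBy ⟨ψ, hψ⟩ i⟩⟩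

end NegGradedVectBundle

theorem isRightAdjoint_splitNManifold : splitNManifold.{u}.IsRightAdjoint := by
  apply Functor.isRightAdjoint_of_leftAdjointObjIsDefined_eq_top
  rw [eq_top_iff]
  intro X _
  obtain ⟨V, e, he⟩ := X.exists_splitting
  obtain ⟨E, -, ⟨c⟩⟩ := NegGradedVectBundle.exists_corepresentableBy
    (NManifold.isoOfAlgEquiv (Y := splitNManifold.obj V) e he)
  exact c.isCorepresentable

end

/-- The functor `𝔖` from `ℤ^{<0}`-graded vector bundles to N-manifolds preserves all limits, and it
is right adjoint to a functor that sends an N-manifold `X` with splitting `V` (that is,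
`X ≅ 𝔖(V)`) to the graded vector bundle `S^{≥ 1}(V)` with its total grading. -/
theorem proposition2p14 :
    PreservesLimitsOfSize.{w, w'} splitNManifold.{u} ∧
    ∃ L : NManifold.{u} ⥤ NegGradedVectBundle.{u},
      Nonempty (L ⊣ splitNManifold.{u}) ∧
      ∀ (X : NManifold.{u}) (V : NegGradedVectBundle.{u}),
        Nonempty (X ≅ splitNManifold.{u}.obj V) → IsReducedSymmetricBundle V (L.obj X) := by
  have := isRightAdjoint_splitNManifold.{u}
  let adj := Adjunction.ofIsRightAdjoint splitNManifold.{u}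
  refine ⟨adj.rightAdjoint_preservesLimits, splitNManifold.leftAdjoint, ⟨adj⟩, ?_⟩
  rintro X V ⟨i⟩
  obtain ⟨E, hE, ⟨c⟩⟩ := NegGradedVectBundle.exists_corepresentableBy i
  -- The adjunction makes `L.obj X` corepresent the same functor as `E`, whichever splitting
  -- produced `E`.
  exact hE.of_iso (c.uniqueUpToIso (adj.corepresentableBy X))
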